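/- **Setting.** Let $\Omega$ be a metric space, $\Phi^t:\Omega\to\Omega$ ($t\in\mathbb R$) a continuous flow, and $\mu$ an invariant ergodic Borel probability measure with compact support $X$. Let $M\supseteq X$ be a compact subset of $\Omega$ that is forward invariant and is a (finite-dimensional) $C^1$ manifold, possibly with boundary, such that the maps $\Phi^t|_M$, $t\ge 0$, are $C^1$. Let $Y$ be a Banach space and $F:\Omega\to Y$ a continuous map with $F|_M$ of class $C^1$. Let $h:[0,\infty)\to(0,\infty)$ be $C^1$ and bounded with bounded derivative, and let $T>0$. For $Q\in\mathbb N$, $Q\geq 1$, and $\Delta t=T/Q$, put $$d_T^2(x,x')=\frac1T\int_0^T\|F(\Phi^tx)-F(\Phi^tx')\|^2\,dt,\qquad d_{T,\Delta t}^2(x,x')=\frac1Q\sum_{q=0}^{Q-1}\|F(\Phi^{q\Delta t}x)-F(\Phi^{q\Delta t}x')\|^2,$$ $k_T=h\circ d_T^2$ and $k_{T,\Delta t}=h\circ d_{T,\Delta t}^2$. For $x_0\in\Omega$ let $x_n=\Phi^{n\Delta t}(x_0)$ and $\mu_N=\frac1N\sum_{n=0}^{N-1}\delta_{x_n}$. On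 the space $C(M)$ of continuous complex-valued functions, with the uniform norm, consider $$\mathcal K_Tf=\int k_T(\cdot,x)f(x)\,d\mu(x),\qquad \mathcal K_{T,\Delta t,N}f=\int k_{T,\Delta t}(\cdot,x)f(x)\,d\mu_N(x)=\frac1N\sum_{n=0}^{N-1}k_{T,\Delta t}(\cdot,x_n)f(x_n).$$ Assume that $x_0\in M$ lies in the basin of $\mu$, i.e. for Lebesgue-almost every $\Delta t>0$ one has $\int f\,d\mu_N\to\int f\,d\mu$ as $N\to\infty$ for all bounded continuous $f:\Omega\to\mathbb R$; and let limits $\Delta t\to0$ be taken along a sequence $\Delta t_i=T/Q_i$ with $Q_i\to\infty$ such that this convergence holds for every $\Delta t_i$. The iterated limit $\lim_{\Delta t\to 0}\lim_{N\to\infty}$ means that the inner limit exists for all sufficiently small $\Delta t$ of the sequence, and that these inner limits converge. Let $\lambda_{0,T}\ge\lambda_{1,T}\ge\cdots$ be the positive eigenvalues of $\mathcal K_T$ in decreasing order, repeated according to multiplicity, and define $\lambda_{j,T,\Delta t,N}$ in the same way for $\mathcal K_{T,\Delta t,N}$ (set to $0$ if there are fewer than $j+1$ positive eigenvalues). If there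 are negative eigenvalues, they are enumerated separately, likewise with multiplicity but in increasing order $\lambda_{0,T}\le\lambda_{1,T}\le\cdots$, and all statements below hold for either enumeration. **Proposition.** Let $\lambda_{j,T}$ be a nonzero eigenvalue of $\mathcal K_T$ and let $\Pi_{j,T}:C(M)\to C(M)$ be the spectral projection onto its eigenspace. (i) $\displaystyle\lim_{\Delta t\to0}\lim_{N\to\infty}\lambda_{j,T,\Delta t,N}=\lambda_{j,T}$. (ii) For every neighborhood $\Sigma\subseteq\mathbb C$ of $\lambda_{j,T}$ with $\sigma(\mathcal K_T)\cap\overline\Sigma=\{\lambda_{j,T}\}$, the spectral projections $\Pi_{\Sigma,T,\Delta t,N}$ of $\mathcal K_{T,\Delta t,N}$ onto $\Sigma$ (in the sense of the holomorphic functional calculus) converge to $\Pi_{j,T}$ in the strong operator topology, in the iterated limit $\Delta t\to0$ after $N\to\infty$. In particular, let $\varphi_{j,T}\in C(M)$ be an eigenfunction of $\mathcal K_T$ for $\lambda_{j,T}$. If $\lambda_{j,T}$ is simple, there are functions $\varphi_{j,T,\Delta t,N}\in C(M)$ which, for all sufficiently small $\Delta t$ and then all sufficiently large $N$, are eigenfunctions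 of $\mathcal K_{T,\Delta t,N}$ for $\lambda_{j,T,\Delta t,N}$, and $$\lim_{\Delta t\to0}\lim_{N\to\infty}\|\varphi_{j,T,\Delta t,N}-\varphi_{j,T}\|_{C(M)}=0.$$ If $\lambda_{j,T}$ has arbitrary multiplicity, the same limit holds for suitable functions $\varphi_{j,T,\Delta t,N}\in C(M)$ which, for all sufficiently small $\Delta t$ and then all sufficiently large $N$, are nonzero and are sums of eigenfunctions of $\mathcal K_{T,\Delta t,N}$ for the eigenvalues $\lambda_{k,T,\Delta t,N}$ with $\lambda_{k,T}=\lambda_{j,T}$. -/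

import Mathlib

open Set Filter Topology MeasureTheory
open scoped Manifold ContDiff

noncomputable section

namespace DelayKernel

/-! ### Dynamics and sampling -/

/-- `μ` is invariant and ergodic under the flow `Φ`: every time-`t` map preserves `μ`, and the
measurable sets that are invariant under the whole flow are null or conull. -/
structure IsErgodicFlow {Ω : Type*} [TopologicalSpace Ω] [MeasurableSpace Ω]
    (Φ : Flow ℝ Ω) (μ : Measure Ω) : Prop where
  measurePreserving : ∀ t : ℝ, MeasurePreserving (Φ t) μ μ
  trivial_of_invariant : ∀ s : Set Ω, MeasurableSet s → (∀ t : ℝ, Φ t ⁻¹' s = s) →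
    μ s = 0 ∨ μ sᶜ = 0

/-- The sampling measure `(1/N) ∑_{n<N} δ_{x_n}` on the orbit `x_n = Φ^{n Δt}(x₀)`
(the zero measure for `N = 0`). -/
def samplingMeasure {Ω : Type*} [TopologicalSpace Ω] [MeasurableSpace Ω]
    (Φ : Flow ℝ Ω) (x₀ : Ω) (Δt : ℝ) (N : ℕ) : Measure Ω :=
  (N : NNReal)⁻¹ • ∑ n ∈ Finset.range N, Measure.dirac (Φ ((n : ℝ) * Δt) x₀)

instance {Ω : Type*} [TopologicalSpace Ω] [MeasurableSpace Ω]
    (Φ : Flow ℝ Ω) (x₀ : Ω) (Δt : ℝ) (N : ℕ) : IsFiniteMeasure (samplingMeasure Φ x₀ Δt N) := by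
  unfold samplingMeasure
  infer_instance

/-- The sampling measures of the orbit of `x₀` at sampling interval `Δt` converge weakly to `μ`. -/
def SamplingConverges {Ω : Type*} [TopologicalSpace Ω] [MeasurableSpace Ω]
    (Φ : Flow ℝ Ω) (μ : Measure Ω) (x₀ : Ω) (Δt : ℝ) : Prop :=
  ∀ f : BoundedContinuousFunction Ω ℝ,
    Tendsto (fun N : ℕ => ∫ x, f x ∂(samplingMeasure Φ x₀ Δt N)) atTop (𝓝 (∫ x, f x ∂μ))

/-- The basin of `μ`: initial states whose sampling measures converge weakly to `μ` for Lebesgue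
almost every sampling interval `Δt > 0`. -/
def basin {Ω : Type*} [TopologicalSpace Ω] [MeasurableSpace Ω]
    (Φ : Flow ℝ Ω) (μ : Measure Ω) : Set Ω :=
  {x₀ | ∀ᵐ Δt ∂(volume.restrict (Ioi (0 : ℝ))), SamplingConverges Φ μ x₀ Δt}

/-! ### Delay-coordinate distances and kernels -/

/-- A positive, bounded, `C¹` shape function on `[0, ∞)` with bounded derivative. Only the values
on `[0, ∞)` matter. -/
structure ShapeFunction where
  toFun : ℝ → ℝ
  pos : ∀ u, 0 ≤ u → 0 < toFun u
  contDiffOn : ContDiffOn ℝ 1 toFun (Ici 0)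
  bounded : ∃ C : ℝ, ∀ u, 0 ≤ u → toFun u ≤ C
  deriv_bounded : ∃ C : ℝ, ∀ u, 0 ≤ u → |derivWithin toFun (Ici 0) u| ≤ C

variable {Ω : Type*} [TopologicalSpace Ω] {Y : Type*} [NormedAddCommGroup Y]

/-- `d_T²(x,x') = (1/T) ∫₀ᵀ ‖F(Φᵗ x) - F(Φᵗ x')‖² dt`. -/
def delayDistSq (Φ : Flow ℝ Ω) (F : C(Ω, Y)) (T : ℝ) (x x' : Ω) : ℝ :=
  T⁻¹ * ∫ t in (0 : ℝ)..T, ‖F (Φ t x) - F (Φ t x')‖ ^ 2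

/-- `d_{T,Δt}²(x,x') = (1/Q) ∑_{q<Q} ‖F(Φ^{q Δt} x) - F(Φ^{q Δt} x')‖²` with `Δt = T / Q`. -/
def discreteDelayDistSq (Φ : Flow ℝ Ω) (F : C(Ω, Y)) (T : ℝ) (Q : ℕ) (x x' : Ω) : ℝ :=
  (Q : ℝ)⁻¹ * ∑ q ∈ Finset.range Q,
    ‖F (Φ ((q : ℝ) * (T / Q)) x) - F (Φ ((q : ℝ) * (T / Q)) x')‖ ^ 2

theorem delayDistSq_nonneg (Φ : Flow ℝ Ω) (F : C(Ω, Y)) (T : ℝ) (x x' : Ω) :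
    0 ≤ delayDistSq Φ F T x x' := by
  unfold delayDistSq
  rcases le_total 0 T with hT | hT
  · exact mul_nonneg (inv_nonneg.2 hT)
      (intervalIntegral.integral_nonneg hT fun t _ => by positivity)
  · rw [intervalIntegral.integral_symm]
    refine mul_nonneg_of_nonpos_of_nonpos (inv_nonpos.2 hT) (neg_nonpos.2 ?_)
    exact intervalIntegral.integral_nonneg hT fun t _ => by positivity

theorem discreteDelayDistSq_nonneg (Φ : Flow ℝ Ω) (F : C(Ω, Y)) (T : ℝ) (Q : ℕ) (x x' : Ω) :
    0 ≤ discreteDelayDistSq Φ F T Q x x' := by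
  unfold discreteDelayDistSq
  positivity

theorem continuous_delayDistSq (Φ : Flow ℝ Ω) (F : C(Ω, Y)) (T : ℝ) :
    Continuous fun p : Ω × Ω => delayDistSq Φ F T p.1 p.2 := by
  unfold delayDistSq
  refine continuous_const.mul ?_
  refine intervalIntegral.continuous_parametric_intervalIntegral_of_continuous'
    (f := fun (p : Ω × Ω) (t : ℝ) => ‖F (Φ t p.1) - F (Φ t p.2)‖ ^ 2) ?_ 0 T
  have h1 : Continuous fun z : (Ω × Ω) × ℝ => Φ z.2 z.1.1 :=
    Φ.continuous continuous_snd (continuous_fst.comp continuous_fst)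
  have h2 : Continuous fun z : (Ω × Ω) × ℝ => Φ z.2 z.1.2 :=
    Φ.continuous continuous_snd (continuous_snd.comp continuous_fst)
  exact (((F.continuous.comp h1).sub (F.continuous.comp h2)).norm).pow 2

theorem continuous_discreteDelayDistSq (Φ : Flow ℝ Ω) (F : C(Ω, Y)) (T : ℝ) (Q : ℕ) :
    Continuous fun p : Ω × Ω => discreteDelayDistSq Φ F T Q p.1 p.2 := by
  unfold discreteDelayDistSq
  refine continuous_const.mul (continuous_finsetSum _ fun q _ => ?_)
  have h1 : Continuous fun z : Ω × Ω => Φ ((q : ℝ) * (T / Q)) z.1 :=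
    Φ.continuous continuous_const continuous_fst
  have h2 : Continuous fun z : Ω × Ω => Φ ((q : ℝ) * (T / Q)) z.2 :=
    Φ.continuous continuous_const continuous_snd
  exact (((F.continuous.comp h1).sub (F.continuous.comp h2)).norm).pow 2

/-- The kernel `k_T = h ∘ d_T²`. -/
def delayKernel (h : ShapeFunction) (Φ : Flow ℝ Ω) (F : C(Ω, Y)) (T : ℝ) : C(Ω × Ω, ℝ) where
  toFun p := h.toFun (delayDistSq Φ F T p.1 p.2)
  continuous_toFun := h.contDiffOn.continuousOn.comp_continuous (continuous_delayDistSq Φ F T)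
    fun p => delayDistSq_nonneg Φ F T p.1 p.2

/-- The kernel `k_{T,Δt} = h ∘ d_{T,Δt}²` with `Δt = T / Q`. -/
def discreteDelayKernel (h : ShapeFunction) (Φ : Flow ℝ Ω) (F : C(Ω, Y)) (T : ℝ) (Q : ℕ) :
    C(Ω × Ω, ℝ) where
  toFun p := h.toFun (discreteDelayDistSq Φ F T Q p.1 p.2)
  continuous_toFun := h.contDiffOn.continuousOn.comp_continuous
    (continuous_discreteDelayDistSq Φ F T Q) fun p => discreteDelayDistSq_nonneg Φ F T Q p.1 p.2

end DelayKernel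

namespace DelayKernel

/-! ### Integral operators on `C(M)` -/

section Operators

variable {Ω : Type*} [MetricSpace Ω] [MeasurableSpace Ω] [BorelSpace Ω]

theorem continuous_kernelIntegral (M : Set Ω) [CompactSpace M] (k : C(Ω × Ω, ℝ))
    (ρ : Measure Ω) [IsFiniteMeasure ρ] (f : C(M, ℂ)) :
    Continuous fun x : M => ∫ y : M, (k ((x : Ω), (y : Ω)) : ℂ) * f y ∂(ρ.comap Subtype.val) := by
  have hc : Continuous (Function.uncurry
      fun (x : M) (y : M) => (k ((x : Ω), (y : Ω)) : ℂ) * f y) := by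
    unfold Function.uncurry
    fun_prop
  simpa using continuous_parametric_integral_of_continuous
    (μ := ρ.comap (Subtype.val : M → Ω)) hc (isCompact_univ : IsCompact (univ : Set M))

/-- The integral operator `f ↦ ∫_M k(·, y) f(y) dρ(y)` on `C(M)`, for a finite measure `ρ` on `Ω`
and a compact set `M`. -/
def integralOperator (M : Set Ω) [CompactSpace M] (k : C(Ω × Ω, ℝ))
    (ρ : Measure Ω) [IsFiniteMeasure ρ] : C(M, ℂ) →L[ℂ] C(M, ℂ) :=
  LinearMap.mkContinuous
    { toFun := fun f =>
        ⟨fun x : M => ∫ y : M, (k ((x : Ω), (y : Ω)) : ℂ) * f y ∂(ρ.comap Subtype.val),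
          continuous_kernelIntegral M k ρ f⟩
      map_add' := by
        intro f g
        ext x
        have hi : ∀ u : C(M, ℂ), Integrable
            (fun y : M => (k ((x : Ω), (y : Ω)) : ℂ) * u y) (ρ.comap Subtype.val) := fun u =>
          (by fun_prop : Continuous
            fun y : M => (k ((x : Ω), (y : Ω)) : ℂ) * u y).integrable_of_hasCompactSupport
            (HasCompactSupport.of_compactSpace _)
        simp only [ContinuousMap.coe_mk, ContinuousMap.add_apply, mul_add]
        exact integral_add (hi f) (hi g)
      map_smul' := by
        intro c f
        ext x
        simp only [ContinuousMap.coe_mk, ContinuousMap.smul_apply, smul_eq_mul, RingHom.id_apply]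
        rw [← integral_const_mul]
        congr 1
        ext y
        ring }
    (‖(k.comp ((ContinuousMap.mk (Subtype.val : M → Ω)).prodMap
        (ContinuousMap.mk (Subtype.val : M → Ω))) : C(M × M, ℝ))‖
      * (ρ.comap (Subtype.val : M → Ω)).real univ)
    (by
      intro f
      set kM : C(M × M, ℝ) := k.comp ((ContinuousMap.mk (Subtype.val : M → Ω)).prodMap
        (ContinuousMap.mk (Subtype.val : M → Ω))) with hkM
      refine (ContinuousMap.norm_le _ (by positivity)).2 fun x => ?_
      have hb : ∀ y : M, ‖(k ((x : Ω), (y : Ω)) : ℂ) * f y‖ ≤ ‖kM‖ * ‖f‖ := by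
        intro y
        rw [norm_mul]
        refine mul_le_mul ?_ (f.norm_coe_le_norm y) (norm_nonneg _) (norm_nonneg _)
        rw [Complex.norm_real]
        exact kM.norm_coe_le_norm (x, y)
      calc ‖∫ y : M, (k ((x : Ω), (y : Ω)) : ℂ) * f y ∂(ρ.comap Subtype.val)‖
          ≤ ‖kM‖ * ‖f‖ * (ρ.comap (Subtype.val : M → Ω)).real univ :=
            norm_integral_le_of_norm_le_const (Eventually.of_forall hb)
        _ = _ := by ring)

variable {Y : Type*} [NormedAddCommGroup Y]

/-- The continuous-time operator `𝒦_T` on `C(M)`. -/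
def limitOperator (M : Set Ω) [CompactSpace M] (h : ShapeFunction) (Φ : Flow ℝ Ω) (F : C(Ω, Y))
    (μ : Measure Ω) [IsFiniteMeasure μ] (T : ℝ) : C(M, ℂ) →L[ℂ] C(M, ℂ) :=
  integralOperator M (delayKernel h Φ F T) μ

/-- The data-driven operator `𝒦_{T,Δt,N}` on `C(M)`, with `Δt = T / Q`. -/
def dataOperator (M : Set Ω) [CompactSpace M] (h : ShapeFunction) (Φ : Flow ℝ Ω) (F : C(Ω, Y))
    (x₀ : Ω) (T : ℝ) (Q N : ℕ) : C(M, ℂ) →L[ℂ] C(M, ℂ) :=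
  integralOperator M (discreteDelayKernel h Φ F T Q) (samplingMeasure Φ x₀ (T / Q) N)

end Operators

/-! ### Eigenvalues with multiplicity, spectral projections, iterated limits -/

section Spectral

variable {E : Type*} [NormedAddCommGroup E] [NormedSpace ℂ E]

/-- The eigenspace of a bounded operator for the eigenvalue `z`. -/
abbrev eigenspace (A : E →L[ℂ] E) (z : ℂ) : Submodule ℂ E :=
  Module.End.eigenspace (A : E →ₗ[ℂ] E) z

/-- The `j`-th (counting from `0`) positive eigenvalue of `A`, in decreasing order and with
multiplicity: the largest `s > 0` such that the eigenvalues `≥ s` have total multiplicity at least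
`j + 1`. It is `0` if there are not that many positive eigenvalues. -/
def topEigenvalue (A : E →L[ℂ] E) (j : ℕ) : ℝ :=
  sSup {s : ℝ | 0 < s ∧
    ((j + 1 : ℕ) : Cardinal) ≤ Module.rank ℂ ↥(⨆ t ∈ Ici s, eigenspace A (t : ℂ))}

/-- The end of the spectrum from which eigenvalues are counted. -/
inductive SpectrumEnd
  | top
  | bottom

/-- The `j`-th eigenvalue of `A` with multiplicity: the positive ones in decreasing order when
counting from the top, the negative ones in increasing order when counting from the bottom. -/
def orderedEigenvalue (e : SpectrumEnd) (A : E →L[ℂ] E) (j : ℕ) : ℝ :=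
  match e with
  | .top => topEigenvalue A j
  | .bottom => -topEigenvalue (-A) j

/-- The spectral (Riesz) projection of `A` at an isolated point `z₀` of its spectrum:
`(1 / 2πi) ∮_{|z - z₀| = r} (z - A)⁻¹ dz`, which does not depend on `r` for small `r > 0`. -/
def rieszProjection (A : E →L[ℂ] E) (z₀ : ℂ) : E →L[ℂ] E :=
  limUnder (𝓝[>] (0 : ℝ)) fun r =>
    (2 * (Real.pi : ℂ) * Complex.I)⁻¹ • ∮ z in C(z₀, r), resolvent A z

/-- The spectral projection of `A` onto `S`, in the sense of the holomorphic functional calculus,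
when `σ(A) ∩ S` consists of finitely many isolated points of `σ(A)`: the contour is a union of small
circles around these points. -/
def spectralProjection (A : E →L[ℂ] E) (S : Set ℂ) : E →L[ℂ] E :=
  ∑ᶠ z ∈ spectrum ℂ A ∩ S, rieszProjection A z

/-- `lim_{i → ∞} lim_{N → ∞} a i N = l`; the inner limit has to exist for all large `i`. -/
def IteratedLimit {X : Type*} [TopologicalSpace X] (a : ℕ → ℕ → X) (l : X) : Prop :=
  ∃ b : ℕ → X, (∀ᶠ i in atTop, Tendsto (a i) atTop (𝓝 (b i))) ∧ Tendsto b atTop (𝓝 l)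

/-- `lim_{i → ∞} lim_{N → ∞} P i N = L` in the strong operator topology. -/
def StrongIteratedLimit (P : ℕ → ℕ → E →L[ℂ] E) (L : E →L[ℂ] E) : Prop :=
  ∃ B : ℕ → E →L[ℂ] E,
    (∀ᶠ i in atTop, ∀ f : E, Tendsto (fun N => P i N f) atTop (𝓝 (B i f))) ∧
      ∀ f : E, Tendsto (fun i => B i f) atTop (𝓝 (L f))

end Spectral

end DelayKernel

end

/-!
The kernels are symmetric, so the operators `𝒦_T`, `𝒦_{T,Δt,N}` and the intermediate
`𝒦_{T,Δt}` (discretized kernel, integrated against `μ`) are compact on `C(M)` and symmetric for the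
`L²` form of their measure, whose null vectors lie in the kernel of the operator. For such an operator
(`SymmetrizableCompact`) the nonzero eigenvalues are real, isolated and semisimple, and the Cauchy
integral of the resolvent over a circle is a projection onto the sum of the eigenspaces for the
disk (`SymmetrizableCompact.contourProjection_mem`, `SymmetrizableCompact.spectralProjection_eq`).

Both limits are instances of one mode of convergence, `NuTendsto`: besides bounded strong
convergence `A_n → A`, the products `(A_n - A) A` and `(A_n - A) A_n` tend to `0` in norm. As
`Δt → 0`, the kernels converge uniformly on `M × M` (Riemann sums of an equicontinuous family), so
that `𝒦_{T,Δt} → 𝒦_T` in norm. As `N → ∞`, a continuous kernel is uniformly close to a finite sum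
of products `a(x) b(y)`, which makes the operators `𝒦_{T,Δt,N}` collectively compact, and weak
convergence of the sampling measures gives strong convergence (`nuTendsto_integralOperator`).

Under this convergence the resolvents converge strongly, with uniform bounds on compact sets away
from `0` and from the spectrum of the limit (`NuTendsto.exists_resolvent_bound`). Hence the Cauchy
integrals converge strongly and their ranks are eventually equal
(`NuTendsto.eventually_finrank_eq`). With circles through `s > 0` and a point beyond all the
norms, the number of eigenvalues above `s` is seen to be stable, which gives the convergence of the
ordered eigenvalues and the matching of their indices; with small circles around an eigenvalue one
gets the spectral projections and, applying them to an eigenfunction of the limit, the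
approximating eigenfunctions. Negative eigenvalues are positive ones of the negated operators.
-/

namespace DelayKernel

/-! ### Resolvents and deflation of symmetrizable compact operators -/

/-- The `J`-orthogonal projection onto a finite-dimensional subspace on which `J` is injective. -/
theorem exists_projection {E H : Type*} [NormedAddCommGroup E] [NormedSpace ℂ E]
    [NormedAddCommGroup H] [InnerProductSpace ℂ H] (J : E →L[ℂ] H) (V : Submodule ℂ E)
    [FiniteDimensional ℂ V] (hV : ∀ f ∈ V, J f = 0 → f = 0) :
    ∃ P : E →L[ℂ] E, (∀ f, P f ∈ V) ∧ (∀ f ∈ V, P f = f) ∧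
      ∀ f, P f = 0 ↔ ∀ v ∈ V, inner ℂ (J v) (J f) = 0 := by
  set j : V →ₗ[ℂ] H := (J : E →ₗ[ℂ] H).domRestrict V
  have hj : Function.Injective j := by
    rw [injective_iff_map_eq_zero]
    exact fun v hv => Subtype.ext (hV v v.2 hv)
  let e : V ≃ₗ[ℂ] LinearMap.range j := LinearEquiv.ofInjective j hj
  let W : Submodule ℂ H := LinearMap.range j
  let e' : W →L[ℂ] V := LinearMap.toContinuousLinearMap (e.symm : W →ₗ[ℂ] V)
  let P : E →L[ℂ] E := V.subtypeL ∘L e' ∘L W.orthogonalProjectionOnto ∘L J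
  refine ⟨P, fun f => (e' (W.orthogonalProjectionOnto (J f))).2, fun f hf => ?_, fun f => ?_⟩
  · have h1 : W.orthogonalProjectionOnto (J f) = e ⟨f, hf⟩ := by
      have : J f = ((e ⟨f, hf⟩ : W) : H) := rfl
      rw [this]
      exact Submodule.orthogonalProjectionOnto_mem_subspace_eq_self _
    change ((e.symm (W.orthogonalProjectionOnto (J f)) : V) : E) = f
    rw [h1, e.symm_apply_apply]
  · have h1 : P f = 0 ↔ W.orthogonalProjectionOnto (J f) = 0 := by
      change ((e.symm (W.orthogonalProjectionOnto (J f)) : V) : E) = 0 ↔ _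
      simp
    rw [h1, Submodule.orthogonalProjectionOnto_eq_zero_iff, Submodule.mem_orthogonal]
    constructor
    · exact fun h v hv => h _ ⟨⟨v, hv⟩, rfl⟩
    · rintro h _ ⟨v, rfl⟩
      exact h v v.2

section Resolvent

variable {E : Type*} [NormedAddCommGroup E] [NormedSpace ℂ E] {A : E →L[ℂ] E} {z : ℂ}

theorem resolvent_mul_sub (hz : z ∈ resolventSet ℂ A) :
    resolvent A z * (algebraMap ℂ (E →L[ℂ] E) z - A) = 1 :=
  Ring.inverse_mul_cancel _ hz

theorem sub_mul_resolvent (hz : z ∈ resolventSet ℂ A) :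
    (algebraMap ℂ (E →L[ℂ] E) z - A) * resolvent A z = 1 :=
  Ring.mul_inverse_cancel _ hz

theorem algebraMap_sub_apply (A : E →L[ℂ] E) (z : ℂ) (f : E) :
    (algebraMap ℂ (E →L[ℂ] E) z - A) f = z • f - A f := by
  simp [Algebra.algebraMap_eq_smul_one]

theorem sub_resolvent_apply (hz : z ∈ resolventSet ℂ A) (f : E) :
    z • resolvent A z f - A (resolvent A z f) = f := by
  rw [← algebraMap_sub_apply]
  exact DFunLike.congr_fun (sub_mul_resolvent hz) f

theorem resolvent_apply_eq (hz : z ∈ resolventSet ℂ A) {f g : E} (h : z • g - A g = f) :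
    resolvent A z f = g := by
  rw [← h, ← algebraMap_sub_apply]
  exact DFunLike.congr_fun (resolvent_mul_sub hz) g

theorem eq_zero_of_mem_resolventSet (hz : z ∈ resolventSet ℂ A) {f : E} (hf : A f = z • f) :
    f = 0 := by
  rw [← resolvent_apply_eq hz (g := f) (f := 0) (by simp [hf]), map_zero]

theorem resolvent_apply_eigenvector (hz : z ∈ resolventSet ℂ A) {w : ℂ} {f : E}
    (hf : A f = w • f) : resolvent A z f = (z - w)⁻¹ • f := by
  rcases eq_or_ne z w with rfl | h
  · simp [eq_zero_of_mem_resolventSet hz hf]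
  · refine resolvent_apply_eq hz ?_
    rw [map_smul, hf, smul_comm z, ← smul_sub, ← sub_smul, smul_smul,
      inv_mul_cancel₀ (sub_ne_zero.2 h), one_smul]

theorem commute_resolvent {B : E →L[ℂ] E} (hB : Commute A B) (hz : z ∈ resolventSet ℂ A) :
    Commute (resolvent A z) B := by
  have h : Commute (algebraMap ℂ (E →L[ℂ] E) z - A) B :=
    Commute.sub_left (Algebra.commutes z B) hB
  calc resolvent A z * B
      = resolvent A z * (B * ((algebraMap ℂ (E →L[ℂ] E) z - A) * resolvent A z)) := by
        rw [sub_mul_resolvent hz, mul_one]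
    _ = resolvent A z * (algebraMap ℂ (E →L[ℂ] E) z - A) * B * resolvent A z := by
        rw [← mul_assoc B, ← h.eq]
        simp only [mul_assoc]
    _ = B * resolvent A z := by rw [resolvent_mul_sub hz, one_mul]

end Resolvent

section SymmetrizableCompact

universe u

variable {E : Type u} [NormedAddCommGroup E] [NormedSpace ℂ E]

/-- A compact operator `A` that is symmetric for some positive semidefinite form whose null vectors
all lie in the kernel of `A`. The form is given as the pullback of an inner product along a bounded map `J`;
for integral operators on `C(M)` with symmetric kernel, `J` is the map into `L²`. Such operators
have real, semisimple nonzero eigenvalues, as self-adjoint ones do. -/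
structure SymmetrizableCompact (A : E →L[ℂ] E) : Prop where
  compact : IsCompactOperator A
  exists_form : ∃ (H : Type u) (_ : NormedAddCommGroup H) (_ : InnerProductSpace ℂ H)
    (J : E →L[ℂ] H), (∀ f g, inner ℂ (J (A f)) (J g) = inner ℂ (J f) (J (A g))) ∧
      ∀ f, J f = 0 → A f = 0

theorem SymmetrizableCompact.neg {A : E →L[ℂ] E} (hA : SymmetrizableCompact A) :
    SymmetrizableCompact (-A) := by
  obtain ⟨H, _, _, J, h1, h2⟩ := hA.exists_form
  exact ⟨hA.compact.neg, H, _, _, J, fun f g => by simp [h1], fun f hf => by simp [h2 f hf]⟩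

theorem mem_eigenspace {A : E →L[ℂ] E} {z : ℂ} {f : E} : f ∈ eigenspace A z ↔ A f = z • f := by
  simp [eigenspace]

theorem eigenspace_neg (A : E →L[ℂ] E) (z : ℂ) : eigenspace (-A) z = eigenspace A (-z) := by
  ext f
  simp only [mem_eigenspace, neg_apply, neg_smul]
  exact neg_eq_iff_eq_neg

/-- The nonzero eigenvalues are real: pair an eigenvector `f` with itself in the symmetrizing form,
which does not vanish at `f` because `A f ≠ 0`. -/
theorem SymmetrizableCompact.eigenvalue_im {A : E →L[ℂ] E} (hA : SymmetrizableCompact A) {z : ℂ}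
    {f : E} (hf : f ≠ 0) (h : A f = z • f) : z.im = 0 := by
  obtain ⟨H, _, _, J, h1, h2⟩ := hA.exists_form
  by_cases hz : z = 0
  · simp [hz]
  have hJ : J f ≠ 0 := fun h0 => by
    have := h2 f h0
    rw [h] at this
    exact (smul_ne_zero hz hf) this
  have := h1 f f
  rw [h, map_smul, inner_smul_left, inner_smul_right] at this
  have h3 := mul_right_cancel₀ (inner_self_ne_zero.2 hJ) this
  exact Complex.conj_eq_iff_im.1 h3

variable [CompleteSpace E]

/-- The Fredholm alternative. -/
theorem mem_resolventSet_of_forall {A : E →L[ℂ] E} (hA : IsCompactOperator A)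
    {z : ℂ} (hz : z ≠ 0) (h : ∀ f, A f = z • f → f = 0) : z ∈ resolventSet ℂ A := by
  refine (hA.hasEigenvalue_or_mem_resolventSet hz).resolve_left fun h' => ?_
  obtain ⟨f, hf⟩ := h'.exists_hasEigenvector
  exact hf.2 (h f (mem_eigenspace.1 hf.1))

theorem SymmetrizableCompact.exists_eigenvector {A : E →L[ℂ] E} (hA : SymmetrizableCompact A)
    {z : ℂ} (hz : z ≠ 0) (h : z ∈ spectrum ℂ A) : ∃ f ≠ 0, A f = z • f := by
  by_contra! h'
  exact h (mem_resolventSet_of_forall hA.compact hz fun f hf => by_contra fun h0 => h' f h0 hf)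

theorem SymmetrizableCompact.spectrum_im {A : E →L[ℂ] E} (hA : SymmetrizableCompact A) {z : ℂ}
    (h : z ∈ spectrum ℂ A) : z.im = 0 := by
  by_cases hz : z = 0
  · simp [hz]
  obtain ⟨f, hf, h⟩ := hA.exists_eigenvector hz h
  exact hA.eigenvalue_im hf h

theorem SymmetrizableCompact.finiteDimensional_eigenspace {A : E →L[ℂ] E}
    (hA : SymmetrizableCompact A) {z : ℂ} (hz : z ≠ 0) : FiniteDimensional ℂ (eigenspace A z) := by
  have hT := hA.compact.restrict'
    ((Module.End.mem_invtSubmodule_iff_forall_mem_of_mem _).mp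
      (Module.End.eigenspace_mem_invtSubmodule (A : E →ₗ[ℂ] E) z))
  rw [Module.End.restrict_eigenspace, LinearMap.coe_smul, IsCompactOperator.smul_iff₀ hz] at hT
  rwa [← isCompactOperator_id_iff_finiteDimensional]

/-- Deflation: the `J`-orthogonal projection `P` onto a finite sum of eigenspaces commutes with `A`,
and subtracting `A P` from `A` removes the corresponding points from the spectrum. -/
theorem SymmetrizableCompact.exists_deflation {A : E →L[ℂ] E} (hA : SymmetrizableCompact A)
    {F : Set ℂ} (hF : F.Finite) (h0 : (0 : ℂ) ∉ F) :
    FiniteDimensional ℂ ↥(⨆ z ∈ F, eigenspace A z) ∧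
    ∃ P : E →L[ℂ] E, (∀ f, P f ∈ ⨆ z ∈ F, eigenspace A z) ∧
      (∀ f ∈ ⨆ z ∈ F, eigenspace A z, P f = f) ∧ Commute A P ∧
      ∀ z ≠ 0, eigenspace A z ≤ ⨆ z ∈ F, eigenspace A z → z ∈ resolventSet ℂ (A - A * P) := by
  set V := ⨆ z ∈ F, eigenspace A z with hVdef
  have hfin : FiniteDimensional ℂ V := by
    have := hF.to_subtype
    have h1 : ∀ z : F, FiniteDimensional ℂ (eigenspace A (z : ℂ)) := fun z =>
      hA.finiteDimensional_eigenspace fun h => h0 (h ▸ z.2)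
    rw [hVdef, iSup_subtype']
    infer_instance
  refine ⟨hfin, ?_⟩
  have hAV : ∀ f ∈ V, A f ∈ V := by
    have : V ≤ V.comap (A : E →ₗ[ℂ] E) := iSup₂_le fun z hz f hf => by
      rw [Submodule.mem_comap, ContinuousLinearMap.coe_coe, mem_eigenspace.1 hf]
      exact V.smul_mem z ((le_iSup₂ (f := fun z (_ : z ∈ F) => eigenspace A z) z hz) hf)
    exact fun f hf => this hf
  -- `A` is injective on `V` because eigenspaces are independent and `0` is not in `F`.
  have hker : ∀ f ∈ V, A f = 0 → f = 0 := by
    intro f hf hAf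
    have hle : V ≤ ⨆ z ≠ (0 : ℂ), eigenspace A z :=
      biSup_mono fun z hz h => h0 (h ▸ hz)
    exact Submodule.disjoint_def.1
      ((Module.End.eigenspaces_iSupIndep (A : E →ₗ[ℂ] E)) 0) f
      (mem_eigenspace.2 (by simpa using hAf)) (hle hf)
  obtain ⟨H, _, _, J, hJ, hJ0⟩ := hA.exists_form
  obtain ⟨P, hP, hPV, hP0⟩ := exists_projection J V fun f hf h => hker f hf (hJ0 f h)
  have hPA : ∀ f, P (A f) = A (P f) := by
    intro f
    have h1 : P (f - P f) = 0 := by rw [map_sub, hPV _ (hP f), sub_self]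
    have h2 : P (A (f - P f)) = 0 := by
      rw [hP0] at h1 ⊢
      intro v hv
      rw [← hJ]
      exact h1 _ (hAV v hv)
    rw [map_sub, map_sub, sub_eq_zero] at h2
    rw [h2, hPV _ (hAV _ (hP f))]
  refine ⟨P, hP, hPV, ContinuousLinearMap.ext fun f => (hPA f).symm, fun z hz hzV => ?_⟩
  refine mem_resolventSet_of_forall (A := A - A * P) (hA.compact.sub (hA.compact.comp_clm P)) hz
    fun f hf => ?_
  have hf' : A f - A (P f) = z • f := hf
  have h1 : P f = 0 := by
    have := congrArg P hf'
    rw [map_sub, hPA, hPA, hPV _ (hP f), sub_self, map_smul] at this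
    exact (smul_eq_zero.1 this.symm).resolve_left hz
  rw [h1, map_zero, sub_zero] at hf'
  rw [← h1, hPV f (hzV (mem_eigenspace.2 hf'))]

/-- The spectrum has no accumulation points except `0`. -/
theorem SymmetrizableCompact.eventually_mem_resolventSet {A : E →L[ℂ] E}
    (hA : SymmetrizableCompact A) {z : ℂ} (hz : z ≠ 0) :
    ∀ᶠ w in 𝓝[≠] z, w ∈ resolventSet ℂ A := by
  obtain ⟨-, P, hP, hPV, hPA, hB⟩ := hA.exists_deflation (finite_singleton z) (by simpa using hz.symm)
  simp only [mem_singleton_iff, iSup_iSup_eq_left] at hP hPV hB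
  have h1 := (spectrum.isOpen_resolventSet (A - A * P)).mem_nhds (hB z hz le_rfl)
  filter_upwards [nhdsWithin_le_nhds h1, nhdsWithin_le_nhds (eventually_ne_nhds hz),
    self_mem_nhdsWithin] with w hw hw0 hwz
  refine mem_resolventSet_of_forall hA.compact hw0 fun f hf => eq_zero_of_mem_resolventSet hw ?_
  have h2 : A (P f) = P (A f) := DFunLike.congr_fun hPA f
  have h3 : z • P f = w • P f := by rw [← mem_eigenspace.1 (hP f), h2, hf, map_smul]
  have h4 : P f = 0 := by
    rw [← sub_eq_zero, ← sub_smul] at h3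
    exact (smul_eq_zero.1 h3).resolve_left (sub_ne_zero.2 (Ne.symm hwz))
  change A f - A (P f) = _
  rw [h4, map_zero, sub_zero, hf]

theorem SymmetrizableCompact.finite_spectrum_inter {A : E →L[ℂ] E}
    (hA : SymmetrizableCompact A) {C : Set ℂ} (hC : IsCompact C) (h0 : (0 : ℂ) ∉ C) :
    (spectrum ℂ A ∩ C).Finite := by
  have hc : IsCompact (spectrum ℂ A ∩ C) := hC.inter_left (spectrum.isClosed A)
  refine hc.finite ?_
  rw [isDiscrete_iff_nhdsNE]
  intro z hz
  rw [inf_principal_eq_bot]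
  filter_upwards [hA.eventually_mem_resolventSet fun h => h0 (h ▸ hz.2)] with w hw hw'
  exact hw'.1 hw

end SymmetrizableCompact

/-! ### Cauchy integrals of the resolvent -/

section EigenspaceSum

variable {E : Type*} [NormedAddCommGroup E] [NormedSpace ℂ E]

/-- The sum of the eigenspaces of `A` for the eigenvalues in `S`. -/
abbrev eigenspaceSum (A : E →L[ℂ] E) (S : Set ℂ) : Submodule ℂ E := ⨆ z ∈ S, eigenspace A z

theorem eigenspaceSum_spectrum_inter (A : E →L[ℂ] E) (S : Set ℂ) :
    eigenspaceSum A (spectrum ℂ A ∩ S) = eigenspaceSum A S := by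
  refine le_antisymm (biSup_mono fun z hz => hz.2) (iSup₂_le fun z hz => ?_)
  by_cases h : z ∈ spectrum ℂ A
  · exact le_iSup₂_of_le z ⟨h, hz⟩ le_rfl
  · intro f hf
    rw [eq_zero_of_mem_resolventSet (not_not.1 h) (mem_eigenspace.1 hf)]
    exact Submodule.zero_mem _

end EigenspaceSum

section Contour

open Metric

variable {E : Type*} [NormedAddCommGroup E] [NormedSpace ℂ E] [CompleteSpace E]
  {A : E →L[ℂ] E} {c : ℂ} {r : ℝ}

/-- The Cauchy integral `(1 / 2πi) ∮_{|z - c| = r} (z - A)⁻¹ dz` of the resolvent: the spectral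
projection of `A` onto the disk when the circle lies in the resolvent set. -/
noncomputable def contourProjection (A : E →L[ℂ] E) (c : ℂ) (r : ℝ) : E →L[ℂ] E :=
  (2 * (Real.pi : ℂ) * Complex.I)⁻¹ • ∮ z in C(c, r), resolvent A z

theorem continuousOn_resolvent (A : E →L[ℂ] E) :
    ContinuousOn (resolvent A) (resolventSet ℂ A) := fun _ hz =>
  (spectrum.hasDerivAt_resolvent_const_left hz).continuousAt.continuousWithinAt

theorem circleIntegral_apply {F G : Type*} [NormedAddCommGroup F] [NormedSpace ℂ F]
    [CompleteSpace F] [NormedAddCommGroup G] [NormedSpace ℂ G] [CompleteSpace G]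
    (L : F →L[ℂ] G) {R : ℂ → F} (hr : 0 ≤ r) (hR : ContinuousOn R (sphere c r)) :
    L (∮ z in C(c, r), R z) = ∮ z in C(c, r), L (R z) := by
  have h := (hR.circleIntegrable hr).out
  rw [circleIntegral, circleIntegral, ← L.intervalIntegral_comp_comm h]
  simp

theorem contourProjection_apply (hr : 0 ≤ r) (hA : sphere c r ⊆ resolventSet ℂ A) (f : E) :
    contourProjection A c r f =
      (2 * (Real.pi : ℂ) * Complex.I)⁻¹ • ∮ z in C(c, r), resolvent A z f := by
  rw [contourProjection, smul_apply]
  congr 1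
  exact circleIntegral_apply (ContinuousLinearMap.apply ℂ E f) hr
    ((continuousOn_resolvent A).mono hA)

theorem commute_contourProjection {B : E →L[ℂ] E} (hB : Commute A B) (hr : 0 ≤ r)
    (hA : sphere c r ⊆ resolventSet ℂ A) : Commute (contourProjection A c r) B := by
  have hc := (continuousOn_resolvent A).mono hA
  refine Commute.smul_left ?_ _
  have h1 := circleIntegral_apply (ContinuousLinearMap.mul ℂ (E →L[ℂ] E) B) hr hc
  have h2 := circleIntegral_apply ((ContinuousLinearMap.mul ℂ (E →L[ℂ] E)).flip B) hr hc
  simp only [ContinuousLinearMap.mul_apply', ContinuousLinearMap.flip_apply] at h1 h2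
  rw [commute_iff_eq, h1, h2]
  exact circleIntegral.integral_congr hr fun z hz => commute_resolvent hB (hA hz)

theorem contourProjection_eigenvector_of_mem (hr : 0 ≤ r) (hA : sphere c r ⊆ resolventSet ℂ A)
    {w : ℂ} (hw : w ∈ ball c r) {f : E} (hf : A f = w • f) : contourProjection A c r f = f := by
  rw [contourProjection_apply hr hA, circleIntegral.integral_congr hr
    (fun z hz => resolvent_apply_eigenvector (hA hz) hf), circleIntegral.integral_smul_const,
    circleIntegral.integral_sub_inv_of_mem_ball hw, inv_smul_smul₀ Complex.two_pi_I_ne_zero]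

theorem contourProjection_eigenvector_of_notMem (hr : 0 ≤ r) (hA : sphere c r ⊆ resolventSet ℂ A)
    {w : ℂ} (hw : w ∉ closedBall c r) {f : E} (hf : A f = w • f) :
    contourProjection A c r f = 0 := by
  have h0 : (∮ z in C(c, r), (z - w)⁻¹) = 0 := by
    refine Complex.circleIntegral_eq_zero_of_differentiable_on_off_countable hr countable_empty
      ?_ fun z hz => ?_
    · exact fun z hz => ((continuousAt_id.sub continuousAt_const).inv₀
        (sub_ne_zero.2 fun h : z = w => hw (h ▸ hz))).continuousWithinAt
    · exact (differentiableAt_id.sub_const w).inv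
        (sub_ne_zero.2 fun h => hw (h ▸ ball_subset_closedBall hz.1))
  rw [contourProjection_apply hr hA, circleIntegral.integral_congr hr
    (fun z hz => resolvent_apply_eigenvector (hA hz) hf), circleIntegral.integral_smul_const, h0,
    zero_smul, smul_zero]

theorem circleIntegral_resolvent_eq_zero (hr : 0 ≤ r) (hA : closedBall c r ⊆ resolventSet ℂ A) :
    (∮ z in C(c, r), resolvent A z) = 0 :=
  Complex.circleIntegral_eq_zero_of_differentiable_on_off_countable hr countable_empty
    ((continuousOn_resolvent A).mono hA) fun _ hz =>
    (spectrum.hasDerivAt_resolvent_const_left (hA (ball_subset_closedBall hz.1))).differentiableAt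

/-- The Riesz projection at an isolated point is the Cauchy integral over any circle around it that
encloses no other point of the spectrum. -/
theorem rieszProjection_eq (hr : 0 < r) (hA : closedBall c r \ {c} ⊆ resolventSet ℂ A) :
    rieszProjection A c = contourProjection A c r := by
  refine Tendsto.limUnder_eq (tendsto_const_nhds.congr' ?_)
  filter_upwards [Ioo_mem_nhdsGT hr] with s hs
  rw [contourProjection]
  congr 1
  have hsub : closedBall c r \ ball c s ⊆ resolventSet ℂ A := fun z hz =>
    hA ⟨hz.1, fun h => hz.2 (by rw [mem_singleton_iff.1 h]; exact mem_ball_self hs.1)⟩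
  refine Complex.circleIntegral_eq_of_differentiable_on_annulus_off_countable hs.1 hs.2.le
    countable_empty ((continuousOn_resolvent A).mono hsub) fun z hz => ?_
  refine (spectrum.hasDerivAt_resolvent_const_left (hsub ?_)).differentiableAt
  exact ⟨ball_subset_closedBall hz.1.1, fun h => hz.1.2 (ball_subset_closedBall h)⟩

end Contour

section Disk

open Metric

universe u

variable {E : Type u} [NormedAddCommGroup E] [NormedSpace ℂ E] [CompleteSpace E]
  {A : E →L[ℂ] E} {c : ℂ} {r : ℝ}

theorem contourProjection_of_mem (hr : 0 ≤ r) (hA : sphere c r ⊆ resolventSet ℂ A) {f : E}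
    (hf : f ∈ eigenspaceSum A (ball c r)) : contourProjection A c r f = f := by
  have : eigenspaceSum A (ball c r) ≤
      LinearMap.eqLocus (contourProjection A c r : E →ₗ[ℂ] E) LinearMap.id :=
    iSup₂_le fun z hz f hf => contourProjection_eigenvector_of_mem hr hA hz (mem_eigenspace.1 hf)
  exact this hf

namespace SymmetrizableCompact

theorem finiteDimensional_eigenspaceSum (hA : SymmetrizableCompact A) {C : Set ℂ}
    (hC : IsCompact C) (h0 : (0 : ℂ) ∉ C) : FiniteDimensional ℂ (eigenspaceSum A C) := by
  rw [← eigenspaceSum_spectrum_inter]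
  exact (hA.exists_deflation (hA.finite_spectrum_inter hC h0) fun h => h0 h.2).1

theorem finiteDimensional_eigenspaceSum_ball (hA : SymmetrizableCompact A)
    (h0 : (0 : ℂ) ∉ closedBall c r) : FiniteDimensional ℂ (eigenspaceSum A (ball c r)) := by
  have := hA.finiteDimensional_eigenspaceSum (isCompact_closedBall c r) h0
  exact Submodule.finiteDimensional_of_le
    (biSup_mono fun z hz => ball_subset_closedBall hz : eigenspaceSum A (ball c r) ≤ _)

/-- The Cauchy integral takes values in the sum of the eigenspaces for the disk. Let `P` be the
`J`-orthogonal projection onto that sum. On the kernel of `P` the operator `A` may be replaced by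
`A - A P`, whose resolvent is holomorphic in the disk, so that the integral vanishes there. -/
theorem contourProjection_mem (hA : SymmetrizableCompact A) (hr : 0 ≤ r)
    (h0 : (0 : ℂ) ∉ closedBall c r) (hs : sphere c r ⊆ resolventSet ℂ A) (f : E) :
    contourProjection A c r f ∈ eigenspaceSum A (ball c r) := by
  have hfin : (spectrum ℂ A ∩ ball c r).Finite :=
    (hA.finite_spectrum_inter (isCompact_closedBall c r) h0).subset
      (inter_subset_inter_right _ ball_subset_closedBall)
  obtain ⟨-, P, hP, hPV, hPA, hB⟩ := hA.exists_deflation hfin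
    fun h => h0 (ball_subset_closedBall h.2)
  change (∀ f, P f ∈ eigenspaceSum A (spectrum ℂ A ∩ ball c r)) at hP
  change (∀ f ∈ eigenspaceSum A (spectrum ℂ A ∩ ball c r), P f = f) at hPV
  change (∀ z ≠ 0, eigenspace A z ≤ eigenspaceSum A (spectrum ℂ A ∩ ball c r) → _) at hB
  rw [eigenspaceSum_spectrum_inter] at hP hPV hB
  set B := A - A * P with hBdef
  have hBρ : closedBall c r ⊆ resolventSet ℂ B := by
    intro z hz
    refine hB z (fun h => h0 (h ▸ hz)) ?_
    rcases eq_or_lt_of_le (mem_closedBall.1 hz) with h | h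
    · intro f hf
      rw [eq_zero_of_mem_resolventSet (hs h) (mem_eigenspace.1 hf)]
      exact Submodule.zero_mem _
    · exact le_iSup₂ (f := fun z (_ : z ∈ ball c r) => eigenspace A z) z h
  have hPA' : ∀ f, P (A f) = A (P f) := fun f => (DFunLike.congr_fun hPA f).symm
  -- on the kernel of `P` the resolvents of `A` and of `B` agree
  have hker : ∀ f, P f = 0 → contourProjection A c r f = 0 := by
    intro f hf
    have hres : ∀ z ∈ sphere c r, resolvent A z f = resolvent B z f := by
      intro z hz
      have hz' := sphere_subset_closedBall hz
      have hg := sub_resolvent_apply (hBρ hz') f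
      set g := resolvent B z f
      have hBg : B g = A g - A (P g) := rfl
      have hPg : P g = 0 := by
        have h1 := congrArg P hg
        rw [map_sub, hBg, map_sub, hPA', hPA', hPV _ (hP g), sub_self, sub_zero, map_smul,
          hf] at h1
        exact (smul_eq_zero.1 h1).resolve_left fun h => h0 (h ▸ hz')
      refine resolvent_apply_eq (hs hz) ?_
      rw [← hg, hBg, hPg, map_zero, sub_zero]
    have h2 := circleIntegral_apply (ContinuousLinearMap.apply ℂ E f) hr
      ((continuousOn_resolvent B).mono (sphere_subset_closedBall.trans hBρ))
    rw [circleIntegral_resolvent_eq_zero hr hBρ, map_zero] at h2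
    rw [contourProjection_apply hr hs, circleIntegral.integral_congr hr hres]
    rw [show (∮ z in C(c, r), resolvent B z f) = 0 from h2.symm, smul_zero]
  have h3 : contourProjection A c r f = contourProjection A c r (P f) := by
    rw [← sub_eq_zero, ← map_sub]
    exact hker _ (by rw [map_sub, hPV _ (hP f), sub_self])
  rw [h3, contourProjection_of_mem hr hs (hP f)]
  exact hP f

/-- The sum of the Riesz projections at the points of the spectrum in a disk is the Cauchy integral
over the boundary of the disk. -/
theorem spectralProjection_eq (hA : SymmetrizableCompact A) (hr : 0 ≤ r)
    (h0 : (0 : ℂ) ∉ closedBall c r) (hs : sphere c r ⊆ resolventSet ℂ A) {S : Set ℂ}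
    (hS : spectrum ℂ A ∩ S = spectrum ℂ A ∩ ball c r) :
    spectralProjection A S = contourProjection A c r := by
  have hfin : (spectrum ℂ A ∩ ball c r).Finite :=
    (hA.finite_spectrum_inter (isCompact_closedBall c r) h0).subset
      (inter_subset_inter_right _ ball_subset_closedBall)
  rw [spectralProjection, hS, finsum_mem_eq_finite_toFinset_sum _ hfin]
  -- small circles isolating each point of the spectrum in the disk
  have hex : ∀ z ∈ spectrum ℂ A ∩ ball c r, ∃ s > 0, (0 : ℂ) ∉ closedBall z s ∧
      closedBall z s ⊆ ball c r ∧ closedBall z s \ {z} ⊆ resolventSet ℂ A := by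
    intro z hz
    have hz0 : z ≠ 0 := fun h => h0 (h ▸ ball_subset_closedBall hz.2)
    have h1 := eventually_nhdsWithin_iff.1 (hA.eventually_mem_resolventSet hz0)
    obtain ⟨s, hs, h⟩ := nhds_basis_closedBall.mem_iff.1
      (h1.and ((eventually_ne_nhds hz0).and (isOpen_ball.mem_nhds hz.2)))
    exact ⟨s, hs, fun h' => (h h').2.1 rfl, fun w hw => (h hw).2.2, fun w hw => (h hw.1).1 hw.2⟩
  choose! s hs0 hs1 hs2 hs3 using hex
  have hsph : ∀ z ∈ spectrum ℂ A ∩ ball c r, sphere z (s z) ⊆ resolventSet ℂ A :=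
    fun z hz w hw => hs3 z hz ⟨sphere_subset_closedBall hw, fun h => by
      rw [mem_singleton_iff.1 h, mem_sphere, dist_self] at hw
      exact (hs0 z hz).ne hw⟩
  rw [Finset.sum_congr rfl fun z hz =>
    rieszProjection_eq (hs0 z (hfin.mem_toFinset.1 hz)) (hs3 z (hfin.mem_toFinset.1 hz))]
  set P := contourProjection A c r
  have hmem : ∀ f, P f ∈ eigenspaceSum A (ball c r) := hA.contourProjection_mem hr h0 hs
  have hsum : ∀ f ∈ eigenspaceSum A (spectrum ℂ A ∩ ball c r),
      (∑ z ∈ hfin.toFinset, contourProjection A z (s z)) f = f := by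
    have : eigenspaceSum A (spectrum ℂ A ∩ ball c r) ≤ LinearMap.eqLocus
        ((∑ z ∈ hfin.toFinset, contourProjection A z (s z) : E →L[ℂ] E) : E →ₗ[ℂ] E)
        LinearMap.id := by
      refine iSup₂_le fun w hw f hf => ?_
      have hf := mem_eigenspace.1 hf
      change (∑ z ∈ hfin.toFinset, contourProjection A z (s z)) f = f
      rw [sum_apply, Finset.sum_eq_single_of_mem w (hfin.mem_toFinset.2 hw)]
      · exact contourProjection_eigenvector_of_mem (hs0 w hw).le (hsph w hw)
          (mem_ball_self (hs0 w hw)) hf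
      · intro z hz hzw
        have hz := hfin.mem_toFinset.1 hz
        exact contourProjection_eigenvector_of_notMem (hs0 z hz).le (hsph z hz)
          (fun h => hw.1 (hs3 z hz ⟨h, hzw.symm⟩)) hf
    exact fun f hf => this hf
  rw [eigenspaceSum_spectrum_inter] at hsum
  ext f
  rw [← hsum (P f) (hmem f), sum_apply, sum_apply]
  refine Finset.sum_congr rfl fun z hz => ?_
  have hz := hfin.mem_toFinset.1 hz
  have hcomm : Commute (contourProjection A z (s z)) P :=
    commute_contourProjection
      (commute_contourProjection (Commute.refl A) hr hs).symm (hs0 z hz).le (hsph z hz)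
  have hmem' := hA.contourProjection_mem (hs0 z hz).le (hs1 z hz) (hsph z hz) f
  have hle : eigenspaceSum A (ball z (s z)) ≤ eigenspaceSum A (ball c r) :=
    biSup_mono fun w hw => hs2 z hz (ball_subset_closedBall hw)
  rw [show contourProjection A z (s z) (P f) = P (contourProjection A z (s z) f) from
    DFunLike.congr_fun hcomm f]
  exact (contourProjection_of_mem hr hs (hle hmem')).symm

end SymmetrizableCompact

end Disk

/-! ### Stability of the resolvent and of the Riesz projections -/

section NuConvergence

open Metric

variable {E : Type*} [NormedAddCommGroup E] [NormedSpace ℂ E]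

/-- `ν`-convergence of bounded operators: bounded strong convergence `A n → B` such that
`(A n - B) B` and `(A n - B) (A n)` tend to `0` in norm. It follows both from norm convergence and
from collectively compact convergence, and it is enough for the convergence of the nonzero part of
the spectrum. -/
structure NuTendsto (A : ℕ → E →L[ℂ] E) (B : E →L[ℂ] E) : Prop where
  bounded : ∃ C, ∀ n, ‖A n‖ ≤ C
  strong : ∀ f, Tendsto (fun n => A n f) atTop (𝓝 (B f))
  sub_mul_limit : Tendsto (fun n => ‖(A n - B) * B‖) atTop (𝓝 0)
  sub_mul_self : Tendsto (fun n => ‖(A n - B) * A n‖) atTop (𝓝 0)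

variable {A : ℕ → E →L[ℂ] E} {B : E →L[ℂ] E}

theorem NuTendsto.neg (h : NuTendsto A B) : NuTendsto (fun n => -A n) (-B) where
  bounded := by simpa using h.bounded
  strong f := by simpa using (h.strong f).neg
  sub_mul_limit := h.sub_mul_limit.congr fun n => by congr 1; noncomm_ring
  sub_mul_self := h.sub_mul_self.congr fun n => by congr 1; noncomm_ring

theorem NuTendsto.of_tendsto (h : Tendsto A atTop (𝓝 B)) : NuTendsto A B where
  bounded := by
    obtain ⟨C, hC⟩ := h.norm.bddAbove_range
    exact ⟨C, fun n => hC (mem_range_self n)⟩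
  strong f := ((ContinuousLinearMap.apply ℂ E f).continuous.tendsto B).comp h
  sub_mul_limit := by
    simpa using ((h.sub_const B).mul_const B).norm
  sub_mul_self := by
    simpa using ((h.sub_const B).mul h).norm

/-- The approximate inverse `z⁻¹ (1 + (z - B)⁻¹ A)` of `z - A`. -/
theorem approxInverse_mul {A B : E →L[ℂ] E} {z : ℂ} (hz : z ≠ 0) (hB : z ∈ resolventSet ℂ B) :
    (z⁻¹ • (1 + resolvent B z * A)) * (algebraMap ℂ _ z - A) =
        1 - z⁻¹ • (resolvent B z * ((A - B) * A)) ∧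
      (algebraMap ℂ _ z - A) * (z⁻¹ • (1 + resolvent B z * A)) =
        1 - (z⁻¹ * z⁻¹) • ((A - B) * A + (A - B) * B * (resolvent B z * A)) := by
  have hzz : z⁻¹ * z⁻¹ * z = z⁻¹ := by rw [mul_assoc, inv_mul_cancel₀ hz, mul_one]
  constructor
  · ext f
    change z⁻¹ • ((algebraMap ℂ (E →L[ℂ] E) z - A) f +
      resolvent B z (A ((algebraMap ℂ (E →L[ℂ] E) z - A) f))) =
      f - z⁻¹ • resolvent B z (A (A f) - B (A f))
    have key : z • resolvent B z (A f) - resolvent B z (B (A f)) = A f := by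
      rw [← map_smul, ← map_sub]
      exact resolvent_apply_eq hB rfl
    have hf : f = z⁻¹ • z • f := (inv_smul_smul₀ hz f).symm
    conv_rhs => arg 1; rw [hf]
    rw [algebraMap_sub_apply, map_sub, map_smul, map_sub, map_smul, map_sub]
    linear_combination (norm := module) z⁻¹ • key
  · ext f
    change (algebraMap ℂ (E →L[ℂ] E) z - A) (z⁻¹ • (f + resolvent B z (A f))) =
      f - (z⁻¹ * z⁻¹) • ((A (A f) - B (A f)) +
        (A (B (resolvent B z (A f))) - B (B (resolvent B z (A f)))))
    have key := sub_resolvent_apply hB (A f)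
    set g := resolvent B z (A f)
    have keyA := congrArg A key
    have keyB := congrArg B key
    rw [map_sub, map_smul] at keyA keyB
    have e : (A (A f) - B (A f)) + (A (B g) - B (B g)) = z • (A g - B g) := by
      rw [← keyA, ← keyB]
      module
    have hf : f = z⁻¹ • z • f := (inv_smul_smul₀ hz f).symm
    conv_rhs => rw [e, smul_smul, hzz, hf]
    rw [map_smul, algebraMap_sub_apply, map_add]
    linear_combination (norm := module) z⁻¹ • key

variable [CompleteSpace E]

/-- Stability of the resolvent: on a compact subset of the resolvent set of the limit that avoids `0`,
the resolvents of `A n` eventually exist and are uniformly bounded. -/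
theorem NuTendsto.exists_resolvent_bound (h : NuTendsto A B) {C : Set ℂ} (hC : IsCompact C)
    (h0 : (0 : ℂ) ∉ C) (hCB : C ⊆ resolventSet ℂ B) :
    ∃ m, ∀ᶠ n in atTop, ∀ z ∈ C, z ∈ resolventSet ℂ (A n) ∧ ‖resolvent (A n) z‖ ≤ m := by
  obtain ⟨m₀, hm₀⟩ := hC.exists_bound_of_continuousOn ((continuousOn_resolvent B).mono hCB)
  obtain ⟨d, hd⟩ := hC.exists_bound_of_continuousOn (f := fun z : ℂ => z⁻¹)
    (continuousOn_inv₀.mono fun z hz hz0 => h0 (hz0 ▸ hz))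
  obtain ⟨K, hK⟩ := h.bounded
  have e1 : ∀ᶠ n in atTop, |d| * (|m₀| * ‖(A n - B) * A n‖) < 1 / 2 := by
    have := (h.sub_mul_self.const_mul |m₀|).const_mul |d|
    rw [mul_zero, mul_zero] at this
    exact this.eventually_lt_const (by norm_num)
  have e2 : ∀ᶠ n in atTop, |d| * |d| * (‖(A n - B) * A n‖ + ‖(A n - B) * B‖ * (|m₀| * K)) < 1 := by
    have := (h.sub_mul_self.add (h.sub_mul_limit.mul_const (|m₀| * K))).const_mul (|d| * |d|)
    rw [zero_mul, add_zero, mul_zero] at this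
    exact this.eventually_lt_const (by norm_num)
  have hone : ‖(1 : E →L[ℂ] E)‖ ≤ 1 := ContinuousLinearMap.norm_id_le
  refine ⟨2 * (|d| * (1 + |m₀| * K)), ?_⟩
  filter_upwards [e1, e2] with n h1 h2 z hz
  have hz0 : z ≠ 0 := fun h => h0 (h ▸ hz)
  have hdz : ‖z⁻¹‖ ≤ |d| := (hd z hz).trans (le_abs_self d)
  have hmz : ‖resolvent B z‖ ≤ |m₀| := (hm₀ z hz).trans (le_abs_self _)
  obtain ⟨hl, hr⟩ := approxInverse_mul (A := A n) hz0 (hCB hz)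
  set U := z⁻¹ • (1 + resolvent B z * A n)
  set e := z⁻¹ • (resolvent B z * ((A n - B) * A n))
  set e' := (z⁻¹ * z⁻¹) • ((A n - B) * A n + (A n - B) * B * (resolvent B z * A n))
  have he : ‖e‖ < 1 / 2 := by
    refine lt_of_le_of_lt ?_ h1
    rw [norm_smul]
    exact mul_le_mul hdz ((norm_mul_le _ _).trans (by gcongr)) (norm_nonneg _) (abs_nonneg _)
  have he' : ‖e'‖ < 1 := by
    refine lt_of_le_of_lt ?_ h2
    rw [norm_smul, norm_mul]
    refine mul_le_mul (by gcongr) ((norm_add_le _ _).trans ?_) (norm_nonneg _) (by positivity)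
    gcongr
    refine (norm_mul_le _ _).trans ?_
    gcongr
    exact (norm_mul_le _ _).trans (mul_le_mul hmz (hK n) (norm_nonneg _) (abs_nonneg _))
  have hU : ‖U‖ ≤ |d| * (1 + |m₀| * K) := by
    rw [norm_smul]
    refine mul_le_mul hdz ((norm_add_le _ _).trans ?_) (norm_nonneg _) (abs_nonneg _)
    refine add_le_add hone ?_
    exact (norm_mul_le _ _).trans (mul_le_mul hmz (hK n) (norm_nonneg _) (abs_nonneg _))
  have hmem : z ∈ resolventSet ℂ (A n) := by
    have u1 : IsUnit (1 - e) := isUnit_one_sub_of_norm_lt_one (he.trans (by norm_num))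
    have u2 : IsUnit (1 - e') := isUnit_one_sub_of_norm_lt_one he'
    refine spectrum.mem_resolventSet_of_left_right_inverse (b := U * Ring.inverse (1 - e'))
      (c := Ring.inverse (1 - e) * U) ?_ ?_
    · rw [← mul_assoc, hr, Ring.mul_inverse_cancel _ u2]
    · rw [mul_assoc, hl, Ring.inverse_mul_cancel _ u1]
  refine ⟨hmem, ?_⟩
  have h3 : resolvent (A n) z = U + e * resolvent (A n) z := by
    have := congrArg (· * resolvent (A n) z) hl
    simp only [mul_assoc, sub_mul_resolvent hmem, mul_one, sub_mul, one_mul] at this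
    rw [this, sub_add_cancel]
  have h4 : ‖resolvent (A n) z‖ ≤ ‖U‖ + ‖e‖ * ‖resolvent (A n) z‖ := by
    conv_lhs => rw [h3]
    exact (norm_add_le _ _).trans (by gcongr; exact norm_mul_le _ _)
  nlinarith [norm_nonneg (resolvent (A n) z)]

/-- Upper semicontinuity of the spectrum. -/
theorem NuTendsto.eventually_subset_resolventSet (h : NuTendsto A B) {C : Set ℂ}
    (hC : IsCompact C) (hCB : C ⊆ resolventSet ℂ B) : ∀ᶠ n in atTop, C ⊆ resolventSet ℂ (A n) := by
  by_cases h0 : (0 : ℂ) ∈ C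
  · -- here `B` is invertible, so that the convergence is in norm
    have hB : IsUnit B := by
      have : IsUnit (algebraMap ℂ (E →L[ℂ] E) 0 - B) := hCB h0
      simpa using this
    have hn : Tendsto A atTop (𝓝 B) := by
      rw [tendsto_iff_norm_sub_tendsto_zero]
      have h1 := h.sub_mul_limit.mul_const ‖Ring.inverse B‖
      rw [zero_mul] at h1
      refine squeeze_zero (fun n => norm_nonneg _) (fun n => ?_) h1
      refine le_trans (le_of_eq ?_) (norm_mul_le _ _)
      rw [mul_assoc, Ring.mul_inverse_cancel _ hB, mul_one]
    have hev : ∀ᶠ a in 𝓝 B, ∀ z ∈ C, IsUnit (algebraMap ℂ (E →L[ℂ] E) z - a) := by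
      refine hC.eventually_forall_of_forall_eventually fun z hz => ?_
      have hcont : Continuous fun p : (E →L[ℂ] E) × ℂ => algebraMap ℂ (E →L[ℂ] E) p.2 - p.1 := by
        fun_prop
      exact hcont.continuousAt.eventually (Units.isOpen.mem_nhds (hCB hz))
    exact hn.eventually hev
  · obtain ⟨m, hm⟩ := h.exists_resolvent_bound hC h0 hCB
    exact hm.mono fun n hn z hz => (hn z hz).1

variable {c : ℂ} {r : ℝ}

/-- The Cauchy integrals of the resolvents converge strongly. -/
theorem NuTendsto.contourProjection_tendsto (h : NuTendsto A B) (hr : 0 ≤ r)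
    (h0 : (0 : ℂ) ∉ sphere c r) (hs : sphere c r ⊆ resolventSet ℂ B) (f : E) :
    Tendsto (fun n => contourProjection (A n) c r f) atTop (𝓝 (contourProjection B c r f)) := by
  have hC := isCompact_sphere c r
  obtain ⟨m, hm⟩ := h.exists_resolvent_bound hC h0 hs
  obtain ⟨m₀, hm₀⟩ := hC.exists_bound_of_continuousOn ((continuousOn_resolvent B).mono hs)
  obtain ⟨d, hd⟩ := hC.exists_bound_of_continuousOn (f := fun z : ℂ => z⁻¹)
    (continuousOn_inv₀.mono fun z hz hz0 => h0 (hz0 ▸ hz))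
  rw [contourProjection_apply hr hs]
  have hev : ∀ᶠ n in atTop, (2 * (Real.pi : ℂ) * Complex.I)⁻¹ •
      (∮ z in C(c, r), resolvent (A n) z f) = contourProjection (A n) c r f := by
    filter_upwards [hm] with n hn
    rw [contourProjection_apply hr fun z hz => (hn z hz).1]
  refine Tendsto.congr' hev (Tendsto.const_smul ?_ _)
  refine TendstoUniformlyOn.tendsto_circleIntegral_of_continuousOn hr ?_ ?_
  · filter_upwards [hm] with n hn
    exact ((continuousOn_resolvent (A n)).mono fun z hz => (hn z hz).1).clm_apply
      continuousOn_const
  · -- `R_n f - R f = z⁻¹ R_n ((A_n - B) f + (A_n - B) B R f)`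
    have ht : Tendsto (fun n => |m| * (|d| * (‖A n f - B f‖ + ‖(A n - B) * B‖ * (|m₀| * ‖f‖))))
        atTop (𝓝 0) := by
      have h1 := tendsto_iff_norm_sub_tendsto_zero.1 (h.strong f)
      have := ((h1.add (h.sub_mul_limit.mul_const (|m₀| * ‖f‖))).const_mul |d|).const_mul |m|
      simpa using this
    rw [Metric.tendstoUniformlyOn_iff]
    intro ε hε
    filter_upwards [hm, ht.eventually_lt_const hε] with n hn hlt z hz
    refine lt_of_le_of_lt ?_ hlt
    have hz0 : z ≠ 0 := fun h => h0 (h ▸ hz)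
    rw [dist_comm, dist_eq_norm]
    have e1 : resolvent (A n) z f - resolvent B z f =
        resolvent (A n) z ((A n - B) (resolvent B z f)) :=
      DFunLike.congr_fun (spectrum.resolvent_sub_resolvent (hn z hz).1 (hs hz)) f
    have e2 : resolvent B z f = z⁻¹ • (f + B (resolvent B z f)) := by
      conv_rhs => rw [← sub_resolvent_apply (hs hz) f, resolvent_apply_eq (g := resolvent B z f)
        (hs hz) rfl, sub_add_cancel, inv_smul_smul₀ hz0]
    have e3 : (A n - B) (resolvent B z f) =
        z⁻¹ • ((A n f - B f) + ((A n - B) * B) (resolvent B z f)) := by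
      conv_lhs => rw [e2, map_smul, map_add]
      rfl
    rw [e1, e3]
    refine (ContinuousLinearMap.le_opNorm _ _).trans ?_
    refine mul_le_mul ((hn z hz).2.trans (le_abs_self m)) ?_ (norm_nonneg _) (abs_nonneg _)
    rw [norm_smul]
    refine mul_le_mul ((hd z hz).trans (le_abs_self d)) ?_ (norm_nonneg _) (abs_nonneg _)
    refine (norm_add_le _ _).trans ?_
    gcongr
    refine (ContinuousLinearMap.le_opNorm _ _).trans ?_
    gcongr
    refine (ContinuousLinearMap.le_opNorm _ _).trans ?_
    gcongr
    exact (hm₀ z hz).trans (le_abs_self _)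

end NuConvergence

section Rank

open Metric

universe u

variable {E : Type u} [NormedAddCommGroup E] [NormedSpace ℂ E] [CompleteSpace E]
  {A : ℕ → E →L[ℂ] E} {B : E →L[ℂ] E} {c : ℂ} {r : ℝ}

/-- The dimension of the sum of the eigenspaces in a disk is lower semicontinuous, because strong
convergence preserves the linear independence of finitely many vectors. -/
theorem NuTendsto.eventually_finrank_le (h : NuTendsto A B) (hA : ∀ n, SymmetrizableCompact (A n))
    (hB : SymmetrizableCompact B) (hr : 0 ≤ r) (h0 : (0 : ℂ) ∉ closedBall c r)
    (hs : sphere c r ⊆ resolventSet ℂ B) :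
    ∀ᶠ n in atTop, Module.finrank ℂ (eigenspaceSum B (ball c r)) ≤
      Module.finrank ℂ (eigenspaceSum (A n) (ball c r)) := by
  have h0' : (0 : ℂ) ∉ sphere c r := fun h => h0 (sphere_subset_closedBall h)
  have := hB.finiteDimensional_eigenspaceSum_ball h0
  let v := Module.finBasis ℂ (eigenspaceSum B (ball c r))
  have hli : LinearIndependent ℂ fun i => (v i : E) :=
    v.linearIndependent.map' _ (Submodule.ker_subtype _)
  have hlim : Tendsto (fun n i => contourProjection (A n) c r (v i : E)) atTop
      (𝓝 fun i => (v i : E)) := by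
    rw [tendsto_pi_nhds]
    intro i
    have := h.contourProjection_tendsto hr h0' hs (v i : E)
    rwa [contourProjection_of_mem hr hs (v i).2] at this
  filter_upwards [hlim.eventually hli.eventually,
    h.eventually_subset_resolventSet (isCompact_sphere c r) hs] with n hn hsn
  have := (hA n).finiteDimensional_eigenspaceSum_ball h0
  have hli' : LinearIndependent ℂ fun i => (⟨contourProjection (A n) c r (v i : E),
      (hA n).contourProjection_mem hr h0 hsn _⟩ : eigenspaceSum (A n) (ball c r)) :=
    LinearIndependent.of_comp (Submodule.subtype _) hn
  simpa using hli'.fintype_card_le_finrank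

/-- On the range of its Riesz projection, `A` has the inverse `(1 / 2πi) ∮ z⁻¹ (z - A)⁻¹ dz`. -/
theorem apply_contourIntegral_inv {A : E →L[ℂ] E} (hr : 0 ≤ r) (h0 : (0 : ℂ) ∉ closedBall c r)
    (hs : sphere c r ⊆ resolventSet ℂ A) (f : E) :
    A ((2 * (Real.pi : ℂ) * Complex.I)⁻¹ • ∮ z in C(c, r), z⁻¹ • resolvent A z f) =
      contourProjection A c r f := by
  have hz0 : ∀ z ∈ closedBall c r, z ≠ 0 := fun z hz h => h0 (h ▸ hz)
  have hinv : ContinuousOn (fun z : ℂ => z⁻¹) (sphere c r) :=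
    continuousOn_inv₀.mono fun z hz => hz0 z (sphere_subset_closedBall hz)
  have hR : ContinuousOn (fun z => resolvent A z f) (sphere c r) :=
    ((continuousOn_resolvent A).mono hs).clm_apply continuousOn_const
  rw [contourProjection_apply hr hs, map_smul,
    circleIntegral_apply (R := fun z => z⁻¹ • resolvent A z f) A hr (hinv.smul hR)]
  congr 1
  have h1 : (∮ z in C(c, r), z⁻¹ • f) = 0 := by
    rw [circleIntegral.integral_smul_const]
    rw [Complex.circleIntegral_eq_zero_of_differentiable_on_off_countable hr countable_empty
      (continuousOn_inv₀.mono hz0)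
      fun z hz => differentiableAt_inv (hz0 z (ball_subset_closedBall hz.1)), zero_smul]
  rw [← sub_zero (∮ z in C(c, r), resolvent A z f), ← h1, ← circleIntegral.integral_sub
    (g := fun z => z⁻¹ • f) (hR.circleIntegrable hr)
    (ContinuousOn.circleIntegrable hr (hinv.smul continuousOn_const))]
  refine circleIntegral.integral_congr hr fun z hz => ?_
  have h2 := sub_resolvent_apply (hs hz) f
  have h3 : A (resolvent A z f) = z • resolvent A z f - f := by
    rw [eq_sub_iff_add_eq, ← eq_sub_iff_add_eq', h2]
  simp only [map_smul, h3, smul_sub, inv_smul_smul₀ (hz0 z (sphere_subset_closedBall hz))]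

/-- The dimension of the sum of the eigenspaces in a disk is upper semicontinuous: the Riesz
projection `P` of the limit is injective on the range of the Riesz projection `P_n` of `A n`. Indeed
`(P_n - P) A_n` is small in norm, and on the range of `P_n` the inverse of `A_n` is bounded. -/
theorem NuTendsto.eventually_le_finrank (h : NuTendsto A B)
    (hB : SymmetrizableCompact B) (hr : 0 ≤ r) (h0 : (0 : ℂ) ∉ closedBall c r)
    (hs : sphere c r ⊆ resolventSet ℂ B) :
    ∀ᶠ n in atTop, Module.finrank ℂ (eigenspaceSum (A n) (ball c r)) ≤
      Module.finrank ℂ (eigenspaceSum B (ball c r)) := by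
  have h0' : (0 : ℂ) ∉ sphere c r := fun h => h0 (sphere_subset_closedBall h)
  have hC := isCompact_sphere c r
  obtain ⟨m, hm⟩ := h.exists_resolvent_bound hC h0' hs
  obtain ⟨m₀, hm₀⟩ := hC.exists_bound_of_continuousOn ((continuousOn_resolvent B).mono hs)
  obtain ⟨d, hd⟩ := hC.exists_bound_of_continuousOn (f := fun z : ℂ => z⁻¹)
    (continuousOn_inv₀.mono fun z hz hz0 => h0' (hz0 ▸ hz))
  have ht : Tendsto (fun n => (r * (|m₀| * ‖(A n - B) * A n‖ * |m|)) * (r * (|d| * |m|)))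
      atTop (𝓝 0) := by
    have := (((h.sub_mul_self.const_mul |m₀|).mul_const |m|).const_mul r).mul_const (r * (|d| * |m|))
    simpa using this
  filter_upwards [hm, ht.eventually_lt_const one_pos] with n hn hlt
  have hsn : sphere c r ⊆ resolventSet ℂ (A n) := fun z hz => (hn z hz).1
  have := hB.finiteDimensional_eigenspaceSum_ball h0
  -- `(P_n - P) A_n` is small in norm
  have hsmall : ∀ w, ‖contourProjection (A n) c r (A n w) - contourProjection B c r (A n w)‖ ≤
      (r * (|m₀| * ‖(A n - B) * A n‖ * |m|)) * ‖w‖ := by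
    intro w
    have hR : ∀ (T : E →L[ℂ] E), sphere c r ⊆ resolventSet ℂ T →
        CircleIntegrable (fun z => resolvent T z (A n w)) c r := fun T hT =>
      (((continuousOn_resolvent T).mono hT).clm_apply continuousOn_const).circleIntegrable hr
    rw [contourProjection_apply hr hsn, contourProjection_apply hr hs, ← smul_sub,
      ← circleIntegral.integral_sub (hR _ hsn) (hR _ hs), mul_assoc r]
    refine circleIntegral.norm_two_pi_i_inv_smul_integral_le_of_norm_le_const hr fun z hz => ?_
    have e1 : resolvent (A n) z (A n w) - resolvent B z (A n w) =
        resolvent B z (((A n - B) * A n) (resolvent (A n) z w)) := by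
      have e2 := DFunLike.congr_fun (spectrum.resolvent_sub_resolvent (hs hz) (hsn hz)) (A n w)
      have e3 : resolvent (A n) z (A n w) = A n (resolvent (A n) z w) :=
        DFunLike.congr_fun (commute_resolvent (Commute.refl (A n)) (hsn hz)) w
      have e4 : resolvent B z (A n w) - resolvent (A n) z (A n w) =
        resolvent B z ((B - A n) (resolvent (A n) z (A n w))) := e2
      rw [← neg_sub, e4, e3, ← map_neg, ← neg_apply, neg_sub]
      rfl
    rw [e1]
    refine (ContinuousLinearMap.le_opNorm _ _).trans ?_
    rw [mul_assoc |m₀|, mul_assoc |m₀|]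
    refine mul_le_mul ((hm₀ z hz).trans (le_abs_self _)) ?_ (norm_nonneg _) (abs_nonneg _)
    refine (ContinuousLinearMap.le_opNorm _ _).trans ?_
    rw [mul_assoc]
    gcongr
    refine (ContinuousLinearMap.le_opNorm _ _).trans ?_
    gcongr
    exact (hn z hz).2.trans (le_abs_self _)
  let L : eigenspaceSum (A n) (ball c r) →ₗ[ℂ] eigenspaceSum B (ball c r) :=
    ((contourProjection B c r : E →ₗ[ℂ] E).codRestrict _
      (hB.contourProjection_mem hr h0 hs)).comp (Submodule.subtype _)
  refine LinearMap.finrank_le_finrank_of_injective (f := L) ?_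
  rw [injective_iff_map_eq_zero]
  rintro ⟨u, hu⟩ hLu
  have hPu : contourProjection B c r u = 0 := congrArg Subtype.val hLu
  refine Subtype.ext ?_
  change u = 0
  have hAw := apply_contourIntegral_inv hr h0 hsn u
  rw [contourProjection_of_mem hr hsn hu] at hAw
  set w := (2 * (Real.pi : ℂ) * Complex.I)⁻¹ • ∮ z in C(c, r), z⁻¹ • resolvent (A n) z u
  have hw : ‖w‖ ≤ r * (|d| * |m|) * ‖u‖ := by
    rw [mul_assoc]
    refine circleIntegral.norm_two_pi_i_inv_smul_integral_le_of_norm_le_const hr fun z hz => ?_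
    rw [norm_smul, mul_assoc]
    refine mul_le_mul ((hd z hz).trans (le_abs_self _)) ?_ (norm_nonneg _) (abs_nonneg _)
    refine (ContinuousLinearMap.le_opNorm _ _).trans ?_
    gcongr
    exact (hn z hz).2.trans (le_abs_self _)
  have h1 := hsmall w
  rw [hAw, hPu, sub_zero, contourProjection_of_mem hr hsn hu] at h1
  by_contra hu0
  have hu1 : 0 < ‖u‖ := norm_pos_iff.2 hu0
  have h2 : ‖u‖ ≤ (r * (|m₀| * ‖(A n - B) * A n‖ * |m|)) * (r * (|d| * |m|)) * ‖u‖ := by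
    refine h1.trans ?_
    rw [mul_assoc _ _ ‖u‖]
    gcongr
  nlinarith

theorem NuTendsto.eventually_finrank_eq (h : NuTendsto A B) (hA : ∀ n, SymmetrizableCompact (A n))
    (hB : SymmetrizableCompact B) (hr : 0 ≤ r) (h0 : (0 : ℂ) ∉ closedBall c r)
    (hs : sphere c r ⊆ resolventSet ℂ B) :
    ∀ᶠ n in atTop, Module.finrank ℂ (eigenspaceSum (A n) (ball c r)) =
      Module.finrank ℂ (eigenspaceSum B (ball c r)) := by
  filter_upwards [h.eventually_finrank_le hA hB hr h0 hs,
    h.eventually_le_finrank hB hr h0 hs] with n h1 h2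
  exact le_antisymm h2 h1

end Rank

/-! ### Enumeration of the positive eigenvalues -/

section Enumeration

open Metric

universe u

variable {E : Type u} [NormedAddCommGroup E] [NormedSpace ℂ E]

/-- The sum of the eigenspaces of `A` for the real eigenvalues `≥ s`. -/
abbrev upperEigenspace (A : E →L[ℂ] E) (s : ℝ) : Submodule ℂ E :=
  ⨆ t ∈ Ici s, eigenspace A (t : ℂ)

theorem upperEigenspace_anti (A : E →L[ℂ] E) : Antitone (upperEigenspace A) := fun _ _ hst =>
  biSup_mono fun _ ht => le_trans hst ht

theorem eigenspace_eq_bot {A : E →L[ℂ] E} {z : ℂ} (hz : z ∈ resolventSet ℂ A) :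
    eigenspace A z = ⊥ :=
  (Submodule.eq_bot_iff _).2 fun _ hf => eq_zero_of_mem_resolventSet hz (mem_eigenspace.1 hf)

theorem eigenspace_eq_bot_of_norm_lt {A : E →L[ℂ] E} {z : ℂ} (hz : ‖A‖ < ‖z‖) :
    eigenspace A z = ⊥ := by
  refine (Submodule.eq_bot_iff _).2 fun f hf => ?_
  by_contra h0
  have h1 := A.le_opNorm f
  rw [mem_eigenspace.1 hf, norm_smul] at h1
  exact absurd (le_of_mul_le_mul_right h1 (norm_pos_iff.2 h0)) (not_le.2 hz)

theorem topEigenvalue_nonneg (A : E →L[ℂ] E) (j : ℕ) : 0 ≤ topEigenvalue A j :=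
  Real.sSup_nonneg fun _ hs => hs.1.le

theorem bddAbove_topEigenvalue (A : E →L[ℂ] E) (j : ℕ) : BddAbove {s : ℝ | 0 < s ∧
    ((j + 1 : ℕ) : Cardinal) ≤ Module.rank ℂ ↥(⨆ t ∈ Ici s, eigenspace A (t : ℂ))} := by
  refine ⟨‖A‖, fun s hs => le_of_not_gt fun h => ?_⟩
  have hbot : (⨆ t ∈ Ici s, eigenspace A (t : ℂ)) = ⊥ := by
    refine iSup₂_eq_bot.2 fun t ht => eigenspace_eq_bot_of_norm_lt ?_
    rw [Complex.norm_real]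
    exact lt_of_lt_of_le h (le_trans ht (le_abs_self t))
  have h2 := hs.2
  rw [hbot, rank_bot] at h2
  exact absurd h2 (not_le.2 (by exact_mod_cast Nat.succ_pos j))

/-- Near an isolated eigenvalue `t` of `B`, the eigenspaces of `B` above `t - r` are those above
`t + r` together with the one for `t`. -/
theorem upperEigenspace_le_sup {B : E →L[ℂ] E} {t r : ℝ}
    (hr : closedBall (t : ℂ) r \ {(t : ℂ)} ⊆ resolventSet ℂ B) {s : ℝ} (hs : t - r ≤ s) :
    upperEigenspace B s ≤ upperEigenspace B (t + r) ⊔ eigenspace B (t : ℂ) := by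
  refine iSup₂_le fun u hu => ?_
  rcases eq_or_ne u t with rfl | hut
  · exact le_sup_right
  rcases le_or_gt (t + r) u with h | h
  · exact le_sup_of_le_left
      (le_iSup₂_of_le (f := fun (t : ℝ) (_ : t ∈ Ici _) => eigenspace B (t : ℂ)) u h le_rfl)
  · rw [eigenspace_eq_bot]
    · exact bot_le
    · refine hr ⟨?_, fun h => hut (Complex.ofReal_injective h)⟩
      rw [mem_closedBall, Complex.dist_of_im_eq (by simp), Complex.ofReal_re, Complex.ofReal_re,
        Real.dist_eq, abs_le]
      have := mem_Ici.1 hu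
      constructor <;> linarith

theorem upperEigenspace_le_of_gt {B : E →L[ℂ] E} {t r : ℝ}
    (hr : closedBall (t : ℂ) r \ {(t : ℂ)} ⊆ resolventSet ℂ B) {s : ℝ} (hs : t < s) :
    upperEigenspace B s ≤ upperEigenspace B (t + r) := by
  refine iSup₂_le fun u hu => ?_
  have hu := mem_Ici.1 hu
  rcases le_or_gt (t + r) u with h | h
  · exact le_iSup₂_of_le (f := fun (t : ℝ) (_ : t ∈ Ici _) => eigenspace B (t : ℂ)) u h le_rfl
  · rw [eigenspace_eq_bot]
    · exact bot_le
    · refine hr ⟨?_, fun h => (hs.trans_le hu).ne' (Complex.ofReal_injective h)⟩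
      rw [mem_closedBall, Complex.dist_of_im_eq (by simp), Complex.ofReal_re, Complex.ofReal_re,
        Real.dist_eq, abs_le]
      constructor <;> linarith

/-- As the eigenvalues are real and at most `‖A‖`, those above `s` are those in the disk with diameter
`[s, R]`, for any `R > ‖A‖`. -/
theorem SymmetrizableCompact.upperEigenspace_eq {A : E →L[ℂ] E} (hA : SymmetrizableCompact A)
    {s R : ℝ}
    (hs : (s : ℂ) ∈ resolventSet ℂ A) (hR : ‖A‖ < R) :
    upperEigenspace A s = eigenspaceSum A (ball (((s + R) / 2 : ℝ) : ℂ) ((R - s) / 2)) := by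
  refine le_antisymm (iSup₂_le fun t ht => ?_) (iSup₂_le fun z hz => ?_)
  · rcases eq_or_lt_of_le (mem_Ici.1 ht) with rfl | hst
    · rw [eigenspace_eq_bot hs]
      exact bot_le
    rcases le_or_gt t ‖A‖ with htA | htA
    · refine le_iSup₂_of_le (f := fun z (_ : z ∈ ball _ _) => eigenspace A z) (t : ℂ) ?_ le_rfl
      rw [mem_ball, Complex.dist_of_im_eq (by simp), Complex.ofReal_re, Complex.ofReal_re,
        Real.dist_eq, abs_lt]
      constructor <;> linarith
    · rw [eigenspace_eq_bot_of_norm_lt]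
      · exact bot_le
      · rw [Complex.norm_real]
        exact lt_of_lt_of_le htA (le_abs_self t)
  · intro f hf
    by_cases hf0 : f = 0
    · rw [hf0]
      exact Submodule.zero_mem _
    have him := hA.eigenvalue_im hf0 (mem_eigenspace.1 hf)
    have hzr : z = (z.re : ℂ) := Complex.ext rfl (by simp [him])
    refine (le_iSup₂_of_le (f := fun (t : ℝ) (_ : t ∈ Ici s) => eigenspace A (t : ℂ)) z.re ?_
      (le_of_eq (by rw [← hzr]))) hf
    rw [mem_ball, Complex.dist_of_im_eq (by simp [him]), Complex.ofReal_re,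
      Real.dist_eq, abs_lt] at hz
    exact mem_Ici.2 (by linarith [hz.1])

variable [CompleteSpace E] {A : E →L[ℂ] E}

theorem mem_resolventSet_of_opNorm_lt {z : ℂ} (hz : ‖A‖ < ‖z‖) :
    z ∈ resolventSet ℂ A :=
  spectrum.mem_resolventSet_of_norm_lt_mul (lt_of_le_of_lt
    (mul_le_of_le_one_right (norm_nonneg _) ContinuousLinearMap.norm_id_le) hz)

namespace SymmetrizableCompact

/-- A circle centred on the real axis meets the spectrum only where it meets the real axis. -/
theorem sphere_subset_resolventSet (hA : SymmetrizableCompact A) {s R : ℝ}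
    (hs : (s : ℂ) ∈ resolventSet ℂ A) (hR : (R : ℂ) ∈ resolventSet ℂ A) :
    sphere (((s + R) / 2 : ℝ) : ℂ) ((R - s) / 2) ⊆ resolventSet ℂ A := by
  intro z hz
  by_contra h
  have him := hA.spectrum_im h
  have hzr : z = (z.re : ℂ) := Complex.ext rfl (by simp [him])
  rw [mem_sphere, Complex.dist_of_im_eq (by simp [him]), Complex.ofReal_re, Real.dist_eq] at hz
  rcases (abs_eq (hz ▸ abs_nonneg _)).1 hz with h1 | h1
  · exact h (by rwa [hzr, show z.re = R by linarith])
  · exact h (by rwa [hzr, show z.re = s by linarith])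

theorem finiteDimensional_upperEigenspace (hA : SymmetrizableCompact A) {s : ℝ} (hs : 0 < s) :
    FiniteDimensional ℂ (upperEigenspace A s) := by
  have := hA.finiteDimensional_eigenspaceSum
    (C := (fun t : ℝ => (t : ℂ)) '' Icc s (max s ‖A‖))
    (isCompact_Icc.image Complex.continuous_ofReal) (by
      rintro ⟨t, ht, h⟩
      rw [Complex.ofReal_eq_zero] at h
      exact absurd ht.1 (by linarith))
  refine Submodule.finiteDimensional_of_le (iSup₂_le fun t ht => ?_ :
    upperEigenspace A s ≤ eigenspaceSum A ((fun t : ℝ => (t : ℂ)) '' Icc s (max s ‖A‖)))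
  rcases le_or_gt t ‖A‖ with htA | htA
  · exact le_iSup₂_of_le (f := fun z (_ : z ∈ _) => eigenspace A z) (t : ℂ)
      ⟨t, ⟨ht, htA.trans (le_max_right _ _)⟩, rfl⟩ le_rfl
  · rw [eigenspace_eq_bot_of_norm_lt]
    · exact bot_le
    · rw [Complex.norm_real]
      exact lt_of_lt_of_le htA (le_abs_self t)

theorem finrank_upperEigenspace_anti (hA : SymmetrizableCompact A) {s t : ℝ} (hs : 0 < s)
    (hst : s ≤ t) :
    Module.finrank ℂ (upperEigenspace A t) ≤ Module.finrank ℂ (upperEigenspace A s) := by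
  have := hA.finiteDimensional_upperEigenspace hs
  exact Submodule.finrank_mono (upperEigenspace_anti A hst)

theorem le_rank_iff (hA : SymmetrizableCompact A) {s : ℝ} (hs : 0 < s) {k : ℕ} :
    (k : Cardinal) ≤ Module.rank ℂ (upperEigenspace A s) ↔
      k ≤ Module.finrank ℂ (upperEigenspace A s) := by
  have := hA.finiteDimensional_upperEigenspace hs
  rw [← Module.finrank_eq_rank, Nat.cast_le]

theorem le_topEigenvalue (hA : SymmetrizableCompact A) {s : ℝ} (hs : 0 < s) {j : ℕ}
    (h : j < Module.finrank ℂ (upperEigenspace A s)) : s ≤ topEigenvalue A j :=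
  le_csSup (bddAbove_topEigenvalue A j) ⟨hs, (hA.le_rank_iff hs).2 h⟩

theorem topEigenvalue_le (hA : SymmetrizableCompact A) {s : ℝ} (hs : 0 < s) {j : ℕ}
    (h : Module.finrank ℂ (upperEigenspace A s) ≤ j) : topEigenvalue A j ≤ s := by
  refine Real.sSup_le (fun t ht => le_of_not_gt fun hst => ?_) hs.le
  have h1 := (hA.le_rank_iff ht.1).1 ht.2
  have h2 := hA.finrank_upperEigenspace_anti hs hst.le
  omega

theorem lt_finrank_of_lt (hA : SymmetrizableCompact A) {s : ℝ} (hs : 0 < s) {j : ℕ}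
    (h : s < topEigenvalue A j) : j < Module.finrank ℂ (upperEigenspace A s) :=
  lt_of_not_ge fun h' => (hA.topEigenvalue_le hs h').not_gt h

theorem finrank_le_of_lt (hA : SymmetrizableCompact A) {s : ℝ} (hs : 0 < s) {j : ℕ}
    (h : topEigenvalue A j < s) : Module.finrank ℂ (upperEigenspace A s) ≤ j :=
  le_of_not_gt fun h' => (hA.le_topEigenvalue hs h').not_gt h

theorem eventually_real_mem_resolventSet (hA : SymmetrizableCompact A) {t : ℝ} (ht : t ≠ 0) :
    ∀ᶠ s : ℝ in 𝓝[≠] t, (s : ℂ) ∈ resolventSet ℂ A := by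
  have h1 : Tendsto (fun s : ℝ => (s : ℂ)) (𝓝[≠] t) (𝓝[≠] (t : ℂ)) :=
    tendsto_nhdsWithin_of_tendsto_nhds_of_eventually_within _
      (Complex.continuous_ofReal.continuousAt.mono_left nhdsWithin_le_nhds)
      (eventually_nhdsWithin_of_forall fun s hs => fun h => hs (Complex.ofReal_injective h))
  exact h1.eventually (hA.eventually_mem_resolventSet (by exact_mod_cast ht))

theorem exists_mem_Ioo_resolventSet (hA : SymmetrizableCompact A) {a b : ℝ} (hab : a < b)
    (ha : 0 ≤ a) : ∃ s ∈ Ioo a b, (s : ℂ) ∈ resolventSet ℂ A := by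
  obtain ⟨t, ht⟩ := exists_between hab
  have h1 : ∀ᶠ s in 𝓝[≠] t, s ∈ Ioo a b := nhdsWithin_le_nhds (Ioo_mem_nhds ht.1 ht.2)
  exact (h1.and (hA.eventually_real_mem_resolventSet (ha.trans_lt ht.1).ne')).exists

theorem exists_isolating_radius (hA : SymmetrizableCompact A) {t : ℝ} (ht : 0 < t) :
    ∃ r > 0, r < t ∧ closedBall (t : ℂ) r \ {(t : ℂ)} ⊆ resolventSet ℂ A := by
  have h1 := eventually_nhdsWithin_iff.1
    (hA.eventually_mem_resolventSet (z := (t : ℂ)) (by exact_mod_cast ht.ne'))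
  obtain ⟨s, hs, h⟩ := nhds_basis_closedBall.mem_iff.1 h1
  refine ⟨min s (t / 2), lt_min hs (by linarith), (min_le_right _ _).trans_lt (by linarith), ?_⟩
  exact fun z hz => h (closedBall_subset_closedBall (min_le_left _ _) hz.1) hz.2

end SymmetrizableCompact

variable {B : E →L[ℂ] E}

/-- The indices of an isolated eigenvalue `t` are those between the numbers of eigenvalues above
`t + r` and above `t - r`. -/
theorem SymmetrizableCompact.topEigenvalue_eq_of_count (hB : SymmetrizableCompact B) {t r : ℝ}
    (hr0 : 0 < r) (hrt : r < t) (hr : closedBall (t : ℂ) r \ {(t : ℂ)} ⊆ resolventSet ℂ B) {k : ℕ}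
    (h1 : k < Module.finrank ℂ (upperEigenspace B (t - r)))
    (h2 : Module.finrank ℂ (upperEigenspace B (t + r)) ≤ k) : topEigenvalue B k = t := by
  have ht : 0 < t := hr0.trans hrt
  refine le_antisymm (le_of_forall_gt_imp_ge_of_dense fun s hs => ?_) ?_
  · refine hB.topEigenvalue_le (ht.trans hs) (le_trans ?_ h2)
    have := hB.finiteDimensional_upperEigenspace (s := t + r) (by linarith)
    exact Submodule.finrank_mono (upperEigenspace_le_of_gt hr hs)
  · refine hB.le_topEigenvalue ht (h1.trans_le ?_)
    have := hB.finiteDimensional_upperEigenspace ht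
    refine Submodule.finrank_mono ((upperEigenspace_le_sup hr le_rfl).trans (sup_le ?_ ?_))
    · exact upperEigenspace_anti B (by linarith)
    · exact le_iSup₂_of_le (f := fun (u : ℝ) (_ : u ∈ Ici t) => eigenspace B (u : ℂ)) t
        self_mem_Ici le_rfl

/-- Every positive eigenvalue occurs in the enumeration. -/
theorem SymmetrizableCompact.exists_index (hA : SymmetrizableCompact A) {t : ℝ} (ht : 0 < t)
    (h : eigenspace A (t : ℂ) ≠ ⊥) : ∃ k, topEigenvalue A k = t ∧
      k < Module.finrank ℂ (upperEigenspace A t) ∧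
      ∀ s > t, Module.finrank ℂ (upperEigenspace A s) ≤ k := by
  -- the index is the number of eigenvalues above `t`
  set U : Submodule ℂ E := ⨆ s ∈ Ioi t, eigenspace A (s : ℂ)
  have hfin := hA.finiteDimensional_upperEigenspace ht
  have hUle : U ≤ upperEigenspace A t := biSup_mono fun s hs => mem_Ici.2 (le_of_lt hs)
  have hUfin : FiniteDimensional ℂ U := Submodule.finiteDimensional_of_le hUle
  have hlt : U < upperEigenspace A t := by
    refine lt_of_le_of_ne hUle fun heq => h ?_
    have h1 : eigenspace A (t : ℂ) ≤ U := by
      rw [heq]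
      exact le_iSup₂_of_le (f := fun (u : ℝ) (_ : u ∈ Ici t) => eigenspace A (u : ℂ)) t
        self_mem_Ici le_rfl
    have h2 : U ≤ ⨆ z ≠ (t : ℂ), eigenspace A z := iSup₂_le fun s hs =>
      le_iSup₂_of_le (f := fun z (_ : z ≠ (t : ℂ)) => eigenspace A z) (s : ℂ)
        (fun h => (ne_of_gt hs) (Complex.ofReal_injective h)) le_rfl
    exact disjoint_self.1
      (((Module.End.eigenspaces_iSupIndep (A : E →ₗ[ℂ] E)) (t : ℂ)).mono_right (h1.trans h2))
  have h1 : Module.finrank ℂ U < Module.finrank ℂ (upperEigenspace A t) :=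
    Submodule.finrank_lt_finrank_of_lt hlt
  have h2 : ∀ s > t, Module.finrank ℂ (upperEigenspace A s) ≤ Module.finrank ℂ U := fun s hs =>
    Submodule.finrank_mono (biSup_mono fun u hu => lt_of_lt_of_le hs hu)
  refine ⟨Module.finrank ℂ U, le_antisymm ?_ (hA.le_topEigenvalue ht h1), h1, h2⟩
  exact le_of_forall_gt_imp_ge_of_dense fun s hs => hA.topEigenvalue_le (ht.trans hs) (h2 s hs)

/-- If `A` and `B` have equally many eigenvalues above `t - r` and above `t + r`, then the
eigenvalues of `A` in between carry the indices that `B` assigns to its eigenvalue `t`. -/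
theorem SymmetrizableCompact.exists_common_index (hA : SymmetrizableCompact A)
    (hB : SymmetrizableCompact B) {t r : ℝ} (hr0 : 0 < r) (hrt : r < t)
    (hr : closedBall (t : ℂ) r \ {(t : ℂ)} ⊆ resolventSet ℂ B)
    (h1 : Module.finrank ℂ (upperEigenspace A (t - r)) =
      Module.finrank ℂ (upperEigenspace B (t - r)))
    (h2 : Module.finrank ℂ (upperEigenspace A (t + r)) =
      Module.finrank ℂ (upperEigenspace B (t + r)))
    {u : ℝ} (hu : u ∈ Ioo (t - r) (t + r)) (hne : eigenspace A (u : ℂ) ≠ ⊥) :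
    ∃ k, topEigenvalue B k = t ∧ topEigenvalue A k = u := by
  obtain ⟨k, hk, hk1, hk2⟩ := hA.exists_index (by linarith [hu.1]) hne
  refine ⟨k, hB.topEigenvalue_eq_of_count hr0 hrt hr ?_ ?_, hk⟩
  · rw [← h1]
    exact hk1.trans_le (hA.finrank_upperEigenspace_anti (by linarith) hu.1.le)
  · rw [← h2]
    exact hk2 _ hu.2

/-- A simple eigenvalue occurs only once in the enumeration. -/
theorem SymmetrizableCompact.index_unique (hB : SymmetrizableCompact B) {t : ℝ} (ht : 0 < t)
    (hdim : Module.finrank ℂ (eigenspace B (t : ℂ)) = 1) {j k : ℕ} (hj : topEigenvalue B j = t)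
    (hk : topEigenvalue B k = t) : j = k := by
  wlog hjk : j < k generalizing j k
  · rcases lt_trichotomy j k with h | h | h
    · exact this hj hk h
    · exact h
    · exact (this hk hj h).symm
  obtain ⟨r, hr0, hrt, hr⟩ := hB.exists_isolating_radius ht
  have h1 := hB.lt_finrank_of_lt (s := t - r) (by linarith) (j := k) (by linarith)
  have h2 := hB.finrank_le_of_lt (s := t + r) (by linarith) (j := j) (by linarith)
  have := hB.finiteDimensional_upperEigenspace (s := t + r) (by linarith)
  have := hB.finiteDimensional_eigenspace (z := (t : ℂ)) (by exact_mod_cast ht.ne')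
  have h3 := Submodule.finrank_mono (upperEigenspace_le_sup hr le_rfl)
  have h4 := Submodule.finrank_add_le_finrank_add_finrank (upperEigenspace B (t + r))
    (eigenspace B (t : ℂ))
  omega

end Enumeration

section EigenvalueConvergence

open Metric

universe u

variable {E : Type u} [NormedAddCommGroup E] [NormedSpace ℂ E] [CompleteSpace E]
  {A : ℕ → E →L[ℂ] E} {B : E →L[ℂ] E}

/-- The number of eigenvalues above a positive `s` in the resolvent set is stable. -/
theorem NuTendsto.eventually_finrank_upperEigenspace_eq (h : NuTendsto A B)
    (hA : ∀ n, SymmetrizableCompact (A n)) (hB : SymmetrizableCompact B) {s : ℝ} (hs : 0 < s)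
    (hsB : (s : ℂ) ∈ resolventSet ℂ B) :
    ∀ᶠ n in atTop, Module.finrank ℂ (upperEigenspace (A n) s) =
      Module.finrank ℂ (upperEigenspace B s) := by
  obtain ⟨C, hC⟩ := h.bounded
  obtain ⟨R, hR⟩ := exists_gt (max (max C ‖B‖) s)
  have hCR : C < R := ((le_max_left _ _).trans (le_max_left _ _)).trans_lt hR
  have hBR : ‖B‖ < R := ((le_max_right _ _).trans (le_max_left _ _)).trans_lt hR
  have hsR : s < R := (le_max_right _ _).trans_lt hR
  have hRB : (R : ℂ) ∈ resolventSet ℂ B := mem_resolventSet_of_opNorm_lt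
    (by rw [Complex.norm_real]; exact hBR.trans_le (le_abs_self R))
  have h0 : (0 : ℂ) ∉ closedBall (((s + R) / 2 : ℝ) : ℂ) ((R - s) / 2) := by
    rw [mem_closedBall, Complex.dist_of_im_eq (by simp), Complex.ofReal_re, Complex.zero_re,
      Real.dist_eq, abs_le]
    rintro ⟨h1, -⟩
    linarith
  filter_upwards [h.eventually_finrank_eq hA hB (by linarith) h0
    (hB.sphere_subset_resolventSet hsB hRB),
    h.eventually_subset_resolventSet isCompact_singleton (singleton_subset_iff.2 hsB)] with n h1 h2
  rw [hB.upperEigenspace_eq hsB hBR, ← h1,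
    (hA n).upperEigenspace_eq (h2 rfl) ((hC n).trans_lt hCR)]

theorem NuTendsto.topEigenvalue_tendsto (h : NuTendsto A B)
    (hA : ∀ n, SymmetrizableCompact (A n)) (hB : SymmetrizableCompact B) (j : ℕ) :
    Tendsto (fun n => topEigenvalue (A n) j) atTop (𝓝 (topEigenvalue B j)) := by
  refine tendsto_order.2 ⟨fun a ha => ?_, fun a ha => ?_⟩
  · rcases lt_or_ge a 0 with h0 | h0
    · exact Eventually.of_forall fun n => h0.trans_le (topEigenvalue_nonneg _ _)
    · obtain ⟨s, hs, hsB⟩ := hB.exists_mem_Ioo_resolventSet ha h0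
      have hs0 := h0.trans_lt hs.1
      filter_upwards [h.eventually_finrank_upperEigenspace_eq hA hB hs0 hsB] with n hn
      exact hs.1.trans_le ((hA n).le_topEigenvalue hs0 (hn ▸ hB.lt_finrank_of_lt hs0 hs.2))
  · obtain ⟨s, hs, hsB⟩ := hB.exists_mem_Ioo_resolventSet ha (topEigenvalue_nonneg B j)
    have hs0 := (topEigenvalue_nonneg B j).trans_lt hs.1
    filter_upwards [h.eventually_finrank_upperEigenspace_eq hA hB hs0 hsB] with n hn
    exact ((hA n).topEigenvalue_le hs0 (hn ▸ hB.finrank_le_of_lt hs0 hs.1)).trans_lt hs.2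

/-- Upper semicontinuity of the spectrum for closed sets, which need not be bounded because the
operators are uniformly bounded. -/
theorem NuTendsto.eventually_isClosed_subset_resolventSet (h : NuTendsto A B) {D : Set ℂ}
    (hD : IsClosed D) (hDB : D ⊆ resolventSet ℂ B) :
    ∀ᶠ n in atTop, D ⊆ resolventSet ℂ (A n) := by
  obtain ⟨C, hC⟩ := h.bounded
  filter_upwards [h.eventually_subset_resolventSet ((isCompact_closedBall (0 : ℂ) C).inter_left hD)
    (inter_subset_left.trans hDB)] with n hn z hz
  rcases le_or_gt ‖z‖ C with hzC | hzC
  · exact hn ⟨hz, by simpa using hzC⟩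
  · exact mem_resolventSet_of_opNorm_lt ((hC n).trans_lt hzC)

end EigenvalueConvergence

/-! ### Iterated limits -/

section IteratedLimits

open Metric

universe u

variable {E : Type u} [NormedAddCommGroup E] [NormedSpace ℂ E] [CompleteSpace E]
  {A : ℕ → ℕ → E →L[ℂ] E} {A' : ℕ → E →L[ℂ] E} {B : E →L[ℂ] E}

theorem iteratedLimit_topEigenvalue (hA : ∀ i n, SymmetrizableCompact (A i n))
    (hA' : ∀ i, SymmetrizableCompact (A' i)) (hB : SymmetrizableCompact B)
    (h : ∀ i, NuTendsto (A i) (A' i)) (h' : NuTendsto A' B) (j : ℕ) :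
    IteratedLimit (fun i n => topEigenvalue (A i n) j) (topEigenvalue B j) :=
  ⟨fun i => topEigenvalue (A' i) j,
    Eventually.of_forall fun i => (h i).topEigenvalue_tendsto (hA i) (hA' i) j,
    h'.topEigenvalue_tendsto hA' hB j⟩

/-- The intermediate limits are the Cauchy integrals of the resolvents of `A' i` over one small circle
around `z`, and this circle also computes the spectral projections of `A i n`. -/
theorem strongIteratedLimit_spectralProjection (hA : ∀ i n, SymmetrizableCompact (A i n))
    (h : ∀ i, NuTendsto (A i) (A' i)) (h' : NuTendsto A' B) {z : ℂ} (hz : z ≠ 0) {S : Set ℂ}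
    (hS : S ∈ 𝓝 z) (hSB : spectrum ℂ B ∩ closure S = {z}) :
    StrongIteratedLimit (fun i n => spectralProjection (A i n) S) (rieszProjection B z) := by
  obtain ⟨r, hr0, hr⟩ := nhds_basis_closedBall.mem_iff.1 (inter_mem hS (isOpen_ne.mem_nhds hz))
  have h0 : (0 : ℂ) ∉ closedBall z r := fun h => (hr h).2 rfl
  have h0' : (0 : ℂ) ∉ sphere z r := fun h => h0 (sphere_subset_closedBall h)
  have hD : closure S \ {z} ⊆ resolventSet ℂ B := fun w hw => by
    by_contra hwB
    exact hw.2 (hSB.subset ⟨hwB, hw.1⟩)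
  have hD' : closure S \ ball z r ⊆ resolventSet ℂ B := fun w hw =>
    hD ⟨hw.1, fun h => hw.2 (by rw [mem_singleton_iff.1 h]; exact mem_ball_self hr0)⟩
  have hsub : sphere z r ⊆ closure S \ ball z r := fun w hw =>
    ⟨subset_closure (hr (sphere_subset_closedBall hw)).1, fun h => (mem_ball.1 h).ne hw⟩
  have hcl : IsClosed (closure S \ ball z r) := isClosed_closure.sdiff isOpen_ball
  refine ⟨fun i => contourProjection (A' i) z r, ?_, fun f => ?_⟩
  · filter_upwards [h'.eventually_isClosed_subset_resolventSet hcl hD'] with i hi f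
    refine ((h i).contourProjection_tendsto hr0.le h0' (hsub.trans hi) f).congr' ?_
    filter_upwards [(h i).eventually_isClosed_subset_resolventSet hcl hi] with n hn
    rw [(hA i n).spectralProjection_eq hr0.le h0 (hsub.trans hn)]
    ext w
    refine ⟨fun hw => ⟨hw.1, ?_⟩, fun hw => ⟨hw.1, (hr (ball_subset_closedBall hw.2)).1⟩⟩
    by_contra hwb
    exact hw.1 (hn ⟨subset_closure hw.2, hwb⟩)
  · rw [rieszProjection_eq hr0 fun w hw => hD ⟨subset_closure (hr hw.1).1, hw.2⟩]
    exact h'.contourProjection_tendsto hr0.le h0' (hsub.trans hD') f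

/-- An eigenvector `φ` of the limit for a positive eigenvalue `t` is approximated by its images
under the Cauchy integrals of the resolvents over one small circle around `t`. -/
theorem exists_iteratedLimit_eigenvectors (hA : ∀ i n, SymmetrizableCompact (A i n))
    (hA' : ∀ i, SymmetrizableCompact (A' i)) (hB : SymmetrizableCompact B)
    (h : ∀ i, NuTendsto (A i) (A' i)) (h' : NuTendsto A' B) {t : ℝ} (ht : 0 < t) {φ : E}
    (hφ0 : φ ≠ 0) (hφ : B φ = (t : ℂ) • φ) :
    ∃ ψ : ℕ → ℕ → E,
      (∀ᶠ i in atTop, ∀ᶠ n in atTop, ψ i n ≠ 0 ∧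
        ψ i n ∈ ⨆ k ∈ {k : ℕ | topEigenvalue B k = t},
          eigenspace (A i n) (topEigenvalue (A i n) k : ℂ)) ∧
      IteratedLimit (fun i n => ‖ψ i n - φ‖) 0 := by
  obtain ⟨r, hr0, hrt, hr⟩ := hB.exists_isolating_radius ht
  have h0 : (0 : ℂ) ∉ closedBall (t : ℂ) r := by
    rw [mem_closedBall, dist_zero_left, Complex.norm_real, Real.norm_eq_abs, abs_of_pos ht]
    exact not_le.2 hrt
  have h0' : (0 : ℂ) ∉ sphere (t : ℂ) r := fun h => h0 (sphere_subset_closedBall h)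
  have hs : sphere (t : ℂ) r ⊆ resolventSet ℂ B := fun w hw =>
    hr ⟨sphere_subset_closedBall hw, fun h => by
      rw [mem_singleton_iff.1 h, mem_sphere, dist_self] at hw
      exact hr0.ne hw⟩
  have hmem : ∀ u : ℝ, |u - t| = r → (u : ℂ) ∈ sphere (t : ℂ) r := fun u hu => by
    rw [mem_sphere, Complex.dist_of_im_eq (by simp), Complex.ofReal_re, Complex.ofReal_re,
      Real.dist_eq, hu]
  have hm := hmem (t - r) (by rw [sub_sub_cancel_left, abs_neg, abs_of_pos hr0])
  have hp := hmem (t + r) (by rw [add_sub_cancel_left, abs_of_pos hr0])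
  have hlimB := h'.contourProjection_tendsto hr0.le h0' hs φ
  rw [contourProjection_eigenvector_of_mem hr0.le hs (mem_ball_self hr0) hφ] at hlimB
  refine ⟨fun i n => contourProjection (A i n) t r φ, ?_,
    fun i => ‖contourProjection (A' i) t r φ - φ‖, ?_, tendsto_iff_norm_sub_tendsto_zero.1 hlimB⟩
  · filter_upwards [h'.eventually_subset_resolventSet (isCompact_sphere _ _) hs,
      h'.eventually_finrank_upperEigenspace_eq hA' hB (by linarith) (hs hm),
      h'.eventually_finrank_upperEigenspace_eq hA' hB (by linarith) (hs hp),
      hlimB.eventually_ne hφ0] with i hsi hmi hpi hne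
    filter_upwards [(h i).eventually_subset_resolventSet (isCompact_sphere _ _) hsi,
      (h i).eventually_finrank_upperEigenspace_eq (hA i) (hA' i) (by linarith) (hsi hm),
      (h i).eventually_finrank_upperEigenspace_eq (hA i) (hA' i) (by linarith) (hsi hp),
      ((h i).contourProjection_tendsto hr0.le h0' hsi φ).eventually_ne hne] with n hsn hmn hpn hne'
    refine ⟨hne', ?_⟩
    have hle : eigenspaceSum (A i n) (ball (t : ℂ) r) ≤
        ⨆ k ∈ {k : ℕ | topEigenvalue B k = t},
          eigenspace (A i n) (topEigenvalue (A i n) k : ℂ) := by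
      refine iSup₂_le fun z hz f hf => ?_
      by_cases hf0 : f = 0
      · rw [hf0]
        exact Submodule.zero_mem _
      have him := (hA i n).eigenvalue_im hf0 (mem_eigenspace.1 hf)
      have hzr : z = (z.re : ℂ) := Complex.ext rfl (by simp [him])
      rw [mem_ball, Complex.dist_of_im_eq (by simp [him]), Complex.ofReal_re,
        Real.dist_eq, abs_lt] at hz
      rw [hzr] at hf
      obtain ⟨k, hk, hk'⟩ := (hA i n).exists_common_index hB hr0 hrt hr (hmn.trans hmi)
        (hpn.trans hpi) (u := z.re) ⟨by linarith [hz.1], by linarith [hz.2]⟩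
        fun hbot => hf0 ((Submodule.mem_bot ℂ).1 (hbot ▸ hf))
      refine (le_iSup₂_of_le (f := fun (k : ℕ) (_ : k ∈ {k : ℕ | topEigenvalue B k = t}) =>
        eigenspace (A i n) (topEigenvalue (A i n) k : ℂ)) k hk ?_) hf
      rw [hk']
    exact hle ((hA i n).contourProjection_mem hr0.le h0 hsn φ)
  · filter_upwards [h'.eventually_subset_resolventSet (isCompact_sphere _ _) hs] with i hsi
    exact (((h i).contourProjection_tendsto hr0.le h0' hsi φ).sub_const φ).norm

end IteratedLimits

/-! ### Integral operators and weak convergence of measures -/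

section Collective

variable {E : Type*} [NormedAddCommGroup E] [NormedSpace ℂ E]

/-- A sequence of operators is collectively approximable if, up to an error `ε` in norm that is
uniform in `n`, all of them take values in one finite-dimensional space, with uniformly bounded
coefficients. It is a convenient form of collective compactness. -/
def CollectivelyApproximable (T : ℕ → E →L[ℂ] E) : Prop :=
  ∀ ε > 0, ∃ (m : ℕ) (a : Fin m → E) (D : ℝ), ∀ n f, ∃ c : Fin m → ℂ,
    (∀ l, ‖c l‖ ≤ D * ‖f‖) ∧ ‖T n f - ∑ l, c l • a l‖ ≤ ε * ‖f‖

/-- Strong convergence to `0` becomes norm convergence after composition with a collectively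
approximable sequence. -/
theorem CollectivelyApproximable.tendsto_mul {T D : ℕ → E →L[ℂ] E}
    (hT : CollectivelyApproximable T) {C : ℝ} (hC : ∀ n, ‖D n‖ ≤ C)
    (hD : ∀ f, Tendsto (fun n => D n f) atTop (𝓝 0)) :
    Tendsto (fun n => ‖D n * T n‖) atTop (𝓝 0) := by
  have hC0 : 0 ≤ C := (norm_nonneg _).trans (hC 0)
  refine tendsto_order.2 ⟨fun a ha => Eventually.of_forall fun n => ha.trans_le (norm_nonneg _),
    fun ε hε => ?_⟩
  obtain ⟨m, a, K, h⟩ := hT (ε / (4 * (C + 1))) (by positivity)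
  have hlim : Tendsto (fun n => ∑ l, K * ‖D n (a l)‖) atTop (𝓝 0) := by
    have : Tendsto (fun n => ∑ l, K * ‖D n (a l)‖) atTop (𝓝 (∑ _l : Fin m, K * ‖(0 : E)‖)) :=
      tendsto_finsetSum _ fun l _ => ((hD (a l)).norm).const_mul K
    simpa using this
  filter_upwards [hlim.eventually_lt_const (show 0 < ε / 4 by positivity)] with n hn
  refine lt_of_le_of_lt (ContinuousLinearMap.opNorm_le_bound _ (show 0 ≤ ε / 2 by positivity)
    fun f => ?_) (by linarith)
  obtain ⟨c, hc, hcf⟩ := h n f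
  have e1 : (D n * T n) f = D n (T n f - ∑ l, c l • a l) + ∑ l, c l • D n (a l) := by
    rw [map_sub, map_sum]
    simp
  rw [e1]
  have b1 : ‖D n (T n f - ∑ l, c l • a l)‖ ≤ ε / 4 * ‖f‖ := by
    calc ‖D n (T n f - ∑ l, c l • a l)‖ ≤ ‖D n‖ * ‖T n f - ∑ l, c l • a l‖ :=
          ContinuousLinearMap.le_opNorm _ _
      _ ≤ C * (ε / (4 * (C + 1)) * ‖f‖) := by gcongr; exact hC n
      _ = (C / (C + 1)) * (ε / 4 * ‖f‖) := by field_simp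
      _ ≤ 1 * (ε / 4 * ‖f‖) := by
          gcongr
          rw [div_le_one (by positivity)]
          linarith
      _ = _ := one_mul _
  have b2 : ‖∑ l, c l • D n (a l)‖ ≤ ε / 4 * ‖f‖ := by
    calc ‖∑ l, c l • D n (a l)‖ ≤ ∑ l, ‖c l • D n (a l)‖ := norm_sum_le _ _
      _ ≤ ∑ l, K * ‖D n (a l)‖ * ‖f‖ := by
          refine Finset.sum_le_sum fun l _ => ?_
          rw [norm_smul, mul_right_comm]
          gcongr
          exact hc l
      _ = (∑ l, K * ‖D n (a l)‖) * ‖f‖ := by rw [Finset.sum_mul]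
      _ ≤ _ := by gcongr
  refine (norm_add_le _ _).trans ?_
  linarith

end Collective

section Approximation

/-- A continuous kernel on a compact space is a uniform limit of sums of products `a(x) b(y)`. -/
theorem exists_tensor_approximation {X : Type*} [TopologicalSpace X] [CompactSpace X] [T2Space X]
    (κ : C(X × X, ℂ)) {ε : ℝ} (hε : 0 < ε) :
    ∃ (m : ℕ) (a b : Fin m → C(X, ℂ)), ∀ x y, ‖κ (x, y) - ∑ l, a l x * b l y‖ ≤ ε := by
  let G : C(X, C(X, ℂ)) := κ.curry
  let U : X → Set X := fun p => {x | ‖G x - G p‖ < ε}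
  have hU : ∀ p, IsOpen (U p) := fun p =>
    isOpen_lt ((G.continuous.sub continuous_const).norm) continuous_const
  obtain ⟨t, ht⟩ := isCompact_univ.elim_finite_subcover U hU fun x _ =>
    mem_iUnion.2 ⟨x, by simpa [U] using hε⟩
  have ht' : (univ : Set X) ⊆ ⋃ p : t, U p := by
    intro x hx
    obtain ⟨p, hp, hxp⟩ := mem_iUnion₂.1 (ht hx)
    exact mem_iUnion.2 ⟨⟨p, hp⟩, hxp⟩
  obtain ⟨ρ, hρ⟩ := PartitionOfUnity.exists_isSubordinate isClosed_univ (fun p : t => U p)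
    (fun p => hU p) ht'
  let e := t.equivFin
  refine ⟨t.card, fun l => ⟨fun x => (ρ (e.symm l) x : ℂ), by fun_prop⟩,
    fun l => G (e.symm l), fun x y => ?_⟩
  have hsum : ∑ p : t, ρ p x = 1 := by
    rw [← finsum_eq_sum_of_fintype]
    exact ρ.sum_eq_one (mem_univ x)
  have hsum' : ∑ p : t, (ρ p x : ℂ) = 1 := by exact_mod_cast hsum
  have e1 : ∑ l, (ρ (e.symm l) x : ℂ) * G (e.symm l) y = ∑ p : t, (ρ p x : ℂ) * G p y :=
    e.symm.sum_comp fun p : t => (ρ p x : ℂ) * G p y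
  change ‖G x y - ∑ l, (ρ (e.symm l) x : ℂ) * G (e.symm l) y‖ ≤ ε
  rw [e1, ← one_mul (G x y), ← hsum', Finset.sum_mul, ← Finset.sum_sub_distrib]
  calc ‖∑ p : t, ((ρ p x : ℂ) * G x y - (ρ p x : ℂ) * G p y)‖
      ≤ ∑ p : t, ‖(ρ p x : ℂ) * G x y - (ρ p x : ℂ) * G p y‖ := norm_sum_le _ _
    _ ≤ ∑ p : t, ρ p x * ε := by
        refine Finset.sum_le_sum fun p _ => ?_
        rw [← mul_sub, norm_mul, Complex.norm_real, Real.norm_of_nonneg (ρ.nonneg p x)]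
        by_cases hp : ρ p x = 0
        · simp [hp]
        refine mul_le_mul_of_nonneg_left ?_ (ρ.nonneg p x)
        have hx : x ∈ U p := hρ p (subset_tsupport _ hp)
        exact ((G x - G p).norm_coe_le_norm y).trans (le_of_lt hx)
    _ = ε := by rw [← Finset.sum_mul, hsum, one_mul]

end Approximation

section Integral

theorem norm_integral_mul_le {M : Type*} [TopologicalSpace M] [CompactSpace M]
    [MeasurableSpace M] (ν : Measure M) [IsFiniteMeasure ν] (b f : C(M, ℂ)) :
    ‖∫ y, b y * f y ∂ν‖ ≤ ‖b‖ * ‖f‖ * ν.real univ :=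
  norm_integral_le_of_norm_le_const (Eventually.of_forall fun y => by
    rw [norm_mul]
    exact mul_le_mul (b.norm_coe_le_norm y) (f.norm_coe_le_norm y) (norm_nonneg _) (norm_nonneg _))

end Integral

section IntegralOperator

universe u

variable {Ω : Type u} [MetricSpace Ω] [MeasurableSpace Ω] [BorelSpace Ω]
  (M : Set Ω) [CompactSpace M]

theorem integralOperator_apply (k : C(Ω × Ω, ℝ)) (ρ : Measure Ω) [IsFiniteMeasure ρ]
    (f : C(M, ℂ)) (x : M) : integralOperator M k ρ f x =
      ∫ y : M, (k ((x : Ω), (y : Ω)) : ℂ) * f y ∂(ρ.comap Subtype.val) := rfl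

variable {M}

theorem integrable_continuousMap (ν : Measure M) [IsFiniteMeasure ν] {g : M → ℂ}
    (hg : Continuous g) : Integrable g ν :=
  hg.integrable_of_hasCompactSupport (HasCompactSupport.of_compactSpace _)

theorem integralOperator_sub (k k' : C(Ω × Ω, ℝ)) (ρ : Measure Ω) [IsFiniteMeasure ρ] :
    integralOperator M k ρ - integralOperator M k' ρ = integralOperator M (k - k') ρ := by
  ext f x
  change integralOperator M k ρ f x - integralOperator M k' ρ f x = _
  rw [integralOperator_apply, integralOperator_apply, integralOperator_apply, ← integral_sub
    (integrable_continuousMap _ (by fun_prop)) (integrable_continuousMap _ (by fun_prop))]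
  congr 1
  ext y
  simp [sub_mul]

theorem norm_integralOperator_le (k : C(Ω × Ω, ℝ)) (ρ : Measure Ω) [IsFiniteMeasure ρ] {c : ℝ}
    (hc0 : 0 ≤ c) (hc : ∀ x ∈ M, ∀ y ∈ M, |k (x, y)| ≤ c) :
    ‖integralOperator M k ρ‖ ≤ c * (ρ.comap (Subtype.val : M → Ω)).real univ := by
  refine ContinuousLinearMap.opNorm_le_bound _ (by positivity) fun f => ?_
  refine (ContinuousMap.norm_le _ (by positivity)).2 fun x => ?_
  rw [integralOperator_apply, mul_right_comm]
  refine norm_integral_le_of_norm_le_const (Eventually.of_forall fun y => ?_)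
  rw [norm_mul, Complex.norm_real]
  exact mul_le_mul (hc x x.2 y y.2) (f.norm_coe_le_norm y) (norm_nonneg _) hc0

/-- The restriction of a kernel to `M`, as a complex-valued function. -/
def restrictedKernel (M : Set Ω) (k : C(Ω × Ω, ℝ)) : C(M × M, ℂ) :=
  ⟨fun p => (k ((p.1 : Ω), (p.2 : Ω)) : ℂ), by fun_prop⟩

theorem norm_integralOperator_sub_sum_le (k : C(Ω × Ω, ℝ)) (ρ : Measure Ω) [IsFiniteMeasure ρ]
    {m : ℕ} {a b : Fin m → C(M, ℂ)} {ε : ℝ} (hε : 0 ≤ ε)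
    (h : ∀ x y, ‖restrictedKernel M k (x, y) - ∑ l, a l x * b l y‖ ≤ ε) (f : C(M, ℂ)) :
    ‖integralOperator M k ρ f -
        ∑ l, (∫ y, b l y * f y ∂(ρ.comap (Subtype.val : M → Ω))) • a l‖ ≤
      ε * ‖f‖ * (ρ.comap (Subtype.val : M → Ω)).real univ := by
  refine (ContinuousMap.norm_le _ (by positivity)).2 fun x => ?_
  have e1 : (integralOperator M k ρ f -
      ∑ l, (∫ y, b l y * f y ∂(ρ.comap (Subtype.val : M → Ω))) • a l) x =
      ∫ y, (restrictedKernel M k (x, y) - ∑ l, a l x * b l y) * f y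
        ∂(ρ.comap (Subtype.val : M → Ω)) := by
    simp only [sub_mul, Finset.sum_mul]
    rw [integral_sub (integrable_continuousMap _ (by fun_prop))
      (integrable_continuousMap _ (by fun_prop)),
      integral_finsetSum _ fun l _ => integrable_continuousMap _ (by fun_prop),
      ContinuousMap.sub_apply, integralOperator_apply, ContinuousMap.sum_apply]
    congr 1
    refine Finset.sum_congr rfl fun l _ => ?_
    rw [ContinuousMap.smul_apply, smul_eq_mul, mul_comm, ← integral_const_mul]
    simp only [mul_assoc]
  rw [e1]
  refine norm_integral_le_of_norm_le_const (Eventually.of_forall fun y => ?_)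
  rw [norm_mul]
  exact mul_le_mul (h x y) (f.norm_coe_le_norm y) (norm_nonneg _) hε

theorem isCompactOperator_integralOperator (k : C(Ω × Ω, ℝ)) (ρ : Measure Ω) [IsFiniteMeasure ρ] :
    IsCompactOperator (integralOperator M k ρ) := by
  set ν := ρ.comap (Subtype.val : M → Ω)
  -- finite-rank operators that approximate the integral operator
  have hex : ∀ n : ℕ, ∃ T : C(M, ℂ) →L[ℂ] C(M, ℂ), IsCompactOperator T ∧
      ‖integralOperator M k ρ - T‖ ≤ (1 / ((n : ℝ) + 1)) * ν.real univ := by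
    intro n
    obtain ⟨m, a, b, hab⟩ := exists_tensor_approximation (restrictedKernel M k)
      (ε := 1 / ((n : ℝ) + 1)) Nat.one_div_pos_of_nat
    let Λ : Fin m → C(M, ℂ) →L[ℂ] ℂ := fun l => LinearMap.mkContinuous
      { toFun := fun f => ∫ y, b l y * f y ∂ν
        map_add' := fun f g => by
          simp only [ContinuousMap.add_apply, mul_add]
          exact integral_add (integrable_continuousMap _ (by fun_prop))
            (integrable_continuousMap _ (by fun_prop))
        map_smul' := fun c f => by
          simp only [ContinuousMap.smul_apply, smul_eq_mul, RingHom.id_apply]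
          rw [← integral_const_mul]
          congr 1
          ext y
          ring } (‖b l‖ * ν.real univ) fun f => by
            rw [mul_right_comm]
            exact norm_integral_mul_le ν (b l) f
    refine ⟨∑ l, (ContinuousLinearMap.toSpanSingleton ℂ (a l)).comp (Λ l), ?_, ?_⟩
    · have h1 : ∀ l, IsCompactOperator
          ((ContinuousLinearMap.toSpanSingleton ℂ (a l)).comp (Λ l)) := fun l =>
        (isCompactOperator_of_locallyCompactSpace_rng
          (ContinuousLinearMap.toSpanSingleton ℂ (a l))).comp_clm (Λ l)
      have h2 : ∀ s : Finset (Fin m), IsCompactOperator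
          (∑ l ∈ s, (ContinuousLinearMap.toSpanSingleton ℂ (a l)).comp (Λ l) :
            C(M, ℂ) →L[ℂ] C(M, ℂ)) := by
        intro s
        induction s using Finset.cons_induction with
        | empty => simpa using isCompactOperator_zero
        | cons l s hl ih =>
          rw [Finset.sum_cons]
          exact (h1 l).add ih
      exact h2 _
    · refine ContinuousLinearMap.opNorm_le_bound _ (by positivity) fun f => ?_
      have h3 := norm_integralOperator_sub_sum_le k ρ (by positivity) hab f
      rw [mul_right_comm] at h3
      refine le_trans (le_of_eq ?_) h3
      rw [sub_apply, sum_apply]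
      rfl
  choose T hT hTn using hex
  refine isCompactOperator_of_tendsto (l := atTop) (F := T) ?_ (Eventually.of_forall hT)
  rw [tendsto_iff_norm_sub_tendsto_zero]
  have hlim : Tendsto (fun n : ℕ => (1 / ((n : ℝ) + 1)) * ν.real univ) atTop (𝓝 0) := by
    simpa using (tendsto_one_div_add_atTop_nhds_zero_nat (𝕜 := ℝ)).mul_const (ν.real univ)
  exact squeeze_zero (fun n => norm_nonneg _) (fun n => by rw [norm_sub_rev]; exact hTn n) hlim

theorem symmetrizableCompact_integralOperator (k : C(Ω × Ω, ℝ)) (hk : ∀ x y, k (x, y) = k (y, x))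
    (ρ : Measure Ω) [IsFiniteMeasure ρ] : SymmetrizableCompact (integralOperator M k ρ) := by
  refine ⟨isCompactOperator_integralOperator k ρ, ?_⟩
  set ν := ρ.comap (Subtype.val : M → Ω) with hν
  refine ⟨Lp ℂ 2 ν, inferInstance, inferInstance, ContinuousMap.toLp 2 ν ℂ, fun f g => ?_,
    fun f hf => ?_⟩
  · rw [ContinuousMap.inner_toLp, ContinuousMap.inner_toLp]
    have e1 : ∀ x, g x * (starRingEnd ℂ) (integralOperator M k ρ f x) =
        ∫ y, g x * ((k ((x : Ω), (y : Ω)) : ℂ) * (starRingEnd ℂ) (f y)) ∂ν := fun x => by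
      rw [integralOperator_apply, ← integral_conj, ← integral_const_mul]
      simp [hν]
    have e2 : ∀ y, integralOperator M k ρ g y * (starRingEnd ℂ) (f y) =
        ∫ x, g x * ((k ((x : Ω), (y : Ω)) : ℂ) * (starRingEnd ℂ) (f y)) ∂ν := fun y => by
      rw [integralOperator_apply, ← integral_mul_const]
      refine integral_congr_ae (Eventually.of_forall fun x => ?_)
      change (k ((y : Ω), (x : Ω)) : ℂ) * g x * _ = _
      rw [hk y x]
      ring
    simp only [e1, e2]
    refine integral_integral_swap_of_hasCompactSupport ?_ (HasCompactSupport.of_compactSpace _)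
    have : Continuous fun z : ℂ => (starRingEnd ℂ) z := Complex.continuous_conj
    unfold Function.uncurry
    fun_prop
  · have h0 : f =ᵐ[ν] 0 := by
      have h1 := ContinuousMap.coeFn_toLp (p := 2) (𝕜 := ℂ) ν f
      rw [hf] at h1
      exact h1.symm.trans (Lp.coeFn_zero ℂ 2 ν)
    ext x
    rw [integralOperator_apply, ContinuousMap.zero_apply]
    refine integral_eq_zero_of_ae ?_
    filter_upwards [h0] with y hy
    rw [hy]
    simp

/-- Weak convergence of the measures implies `ν`-convergence of the integral operators. -/
theorem nuTendsto_integralOperator (k : C(Ω × Ω, ℝ)) (ρ : ℕ → Measure Ω)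
    [∀ n, IsFiniteMeasure (ρ n)] (μ : Measure Ω) [IsFiniteMeasure μ]
    (hρ : ∀ n, ((ρ n).comap (Subtype.val : M → Ω)).real univ ≤ 1)
    (hμ : (μ.comap (Subtype.val : M → Ω)).real univ ≤ 1)
    (hlim : ∀ f : C(M, ℂ), Tendsto (fun n => ∫ y, f y ∂((ρ n).comap (Subtype.val : M → Ω))) atTop
      (𝓝 (∫ y, f y ∂(μ.comap (Subtype.val : M → Ω))))) :
    NuTendsto (fun n => integralOperator M k (ρ n)) (integralOperator M k μ) := by
  have hbd : ∀ x ∈ M, ∀ y ∈ M, |k (x, y)| ≤ ‖restrictedKernel M k‖ := fun x hx y hy => by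
    have := (restrictedKernel M k).norm_coe_le_norm (⟨x, hx⟩, ⟨y, hy⟩)
    rwa [show restrictedKernel M k (⟨x, hx⟩, ⟨y, hy⟩) = (k (x, y) : ℂ) from rfl,
      Complex.norm_real] at this
  have hnorm : ∀ (σ : Measure Ω) [IsFiniteMeasure σ],
      (σ.comap (Subtype.val : M → Ω)).real univ ≤ 1 →
      ‖integralOperator M k σ‖ ≤ ‖restrictedKernel M k‖ := fun σ _ hσ =>
    (norm_integralOperator_le k σ (norm_nonneg _) hbd).trans
      (mul_le_of_le_one_right (norm_nonneg _) hσ)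
  have happ : ∀ (σ : ℕ → Measure Ω) [∀ n, IsFiniteMeasure (σ n)],
      (∀ n, ((σ n).comap (Subtype.val : M → Ω)).real univ ≤ 1) →
      CollectivelyApproximable fun n => integralOperator M k (σ n) := by
    intro σ _ hσ ε hε
    obtain ⟨m, a, b, hab⟩ := exists_tensor_approximation (restrictedKernel M k) hε
    refine ⟨m, a, ∑ l, ‖b l‖, fun n f => ⟨fun l => ∫ y, b l y * f y ∂((σ n).comap Subtype.val),
      fun l => ?_, ?_⟩⟩
    · refine (norm_integral_mul_le _ (b l) f).trans
        ((mul_le_of_le_one_right (by positivity) (hσ n)).trans ?_)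
      gcongr
      exact Finset.single_le_sum (f := fun l => ‖b l‖) (fun _ _ => norm_nonneg _)
        (Finset.mem_univ l)
    · exact (norm_integralOperator_sub_sum_le k (σ n) hε.le hab f).trans
        (mul_le_of_le_one_right (by positivity) (hσ n))
  have hstrong : ∀ f, Tendsto (fun n => integralOperator M k (ρ n) f) atTop
      (𝓝 (integralOperator M k μ f)) := by
    intro f
    rw [tendsto_iff_norm_sub_tendsto_zero]
    refine tendsto_order.2 ⟨fun a ha => Eventually.of_forall fun n => ha.trans_le (norm_nonneg _),
      fun ε hε => ?_⟩
    obtain ⟨m, a, b, hab⟩ := exists_tensor_approximation (restrictedKernel M k)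
      (ε := ε / (4 * (‖f‖ + 1))) (by positivity)
    have herr : ∀ (σ : Measure Ω) [IsFiniteMeasure σ],
        (σ.comap (Subtype.val : M → Ω)).real univ ≤ 1 →
        ‖integralOperator M k σ f -
          ∑ l, (∫ y, b l y * f y ∂(σ.comap (Subtype.val : M → Ω))) • a l‖ ≤ ε / 4 := by
      intro σ _ hσ
      refine (norm_integralOperator_sub_sum_le k σ (by positivity) hab f).trans
        ((mul_le_of_le_one_right (by positivity) hσ).trans ?_)
      rw [div_mul_eq_mul_div, div_le_div_iff₀ (by positivity) (by norm_num)]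
      nlinarith [norm_nonneg f]
    have hsum : Tendsto
        (fun n => ∑ l, (∫ y, b l y * f y ∂((ρ n).comap (Subtype.val : M → Ω))) • a l) atTop
        (𝓝 (∑ l, (∫ y, b l y * f y ∂(μ.comap (Subtype.val : M → Ω))) • a l)) :=
      tendsto_finsetSum _ fun l _ => (hlim (b l * f)).smul_const (a l)
    filter_upwards [(tendsto_iff_norm_sub_tendsto_zero.1 hsum).eventually_lt_const
      (show 0 < ε / 2 by positivity)] with n hn
    have h1 := herr (ρ n) (hρ n)
    have h2 := herr μ hμ
    set S := ∑ l, (∫ y, b l y * f y ∂((ρ n).comap (Subtype.val : M → Ω))) • a l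
    set S' := ∑ l, (∫ y, b l y * f y ∂(μ.comap (Subtype.val : M → Ω))) • a l
    calc ‖integralOperator M k (ρ n) f - integralOperator M k μ f‖
        = ‖(integralOperator M k (ρ n) f - S) - (integralOperator M k μ f - S') + (S - S')‖ := by
          congr 1
          abel
      _ ≤ ‖integralOperator M k (ρ n) f - S‖ + ‖integralOperator M k μ f - S'‖ + ‖S - S'‖ :=
          (norm_add_le _ _).trans (by gcongr; exact norm_sub_le _ _)
      _ < ε := by linarith
  have hdiff : ∀ f, Tendsto (fun n => (integralOperator M k (ρ n) - integralOperator M k μ) f)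
      atTop (𝓝 0) := fun f => by
    simpa using (hstrong f).sub_const (integralOperator M k μ f)
  have hC : ∀ n, ‖integralOperator M k (ρ n) - integralOperator M k μ‖ ≤
      ‖restrictedKernel M k‖ + ‖restrictedKernel M k‖ := fun n =>
    (norm_sub_le _ _).trans (add_le_add (hnorm _ (hρ n)) (hnorm _ hμ))
  exact ⟨⟨_, fun n => hnorm _ (hρ n)⟩, hstrong, (happ (fun _ => μ) fun _ => hμ).tendsto_mul hC hdiff,
    (happ ρ hρ).tendsto_mul hC hdiff⟩

end IntegralOperator

section SamplingMeasure

theorem samplingMeasure_real_le_one {Ω : Type*} [TopologicalSpace Ω] [MeasurableSpace Ω]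
    (Φ : Flow ℝ Ω) (x₀ : Ω) (Δt : ℝ) (N : ℕ) (s : Set Ω) :
    (samplingMeasure Φ x₀ Δt N).real s ≤ 1 := by
  have h1 : (samplingMeasure Φ x₀ Δt N) univ ≤ 1 := by
    rw [samplingMeasure, Measure.smul_apply, Measure.finsetSum_apply]
    simp only [Measure.dirac_apply_of_mem (mem_univ _), Finset.sum_const, Finset.card_range,
      nsmul_eq_mul, mul_one]
    rcases eq_or_ne N 0 with rfl | hN
    · simp
    · rw [ENNReal.smul_def, smul_eq_mul, ENNReal.coe_inv (by exact_mod_cast hN)]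
      exact le_of_eq (ENNReal.inv_mul_cancel (by simpa using hN) (by simp))
  exact ENNReal.toReal_le_of_le_ofReal zero_le_one
    ((measure_mono (subset_univ s)).trans (by simpa using h1))

end SamplingMeasure

section WeakConvergence

variable {Ω : Type*} [MetricSpace Ω] [MeasurableSpace Ω] [BorelSpace Ω]

theorem measurableSet_of_compactSpace (M : Set Ω) [CompactSpace M] : MeasurableSet M :=
  (isCompact_iff_compactSpace.2 ‹_›).isClosed.measurableSet

theorem comap_real_univ (M : Set Ω) [CompactSpace M] (ρ : Measure Ω) :
    (ρ.comap (Subtype.val : M → Ω)).real univ = ρ.real M := by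
  rw [Measure.real, Measure.real,
    comap_subtype_coe_apply (measurableSet_of_compactSpace M) ρ univ]
  simp

/-- Weak convergence on `Ω` of measures carried by a compact set `M` implies weak convergence on
`M`, by the Tietze extension theorem. -/
theorem tendsto_integral_comap {M : Set Ω} [CompactSpace M] {ρ : ℕ → Measure Ω} {μ : Measure Ω}
    [∀ n, IsFiniteMeasure (ρ n)] [IsFiniteMeasure μ] (hρ : ∀ n, ρ n Mᶜ = 0) (hμ : μ Mᶜ = 0)
    (h : ∀ f : BoundedContinuousFunction Ω ℝ,
      Tendsto (fun n => ∫ x, f x ∂(ρ n)) atTop (𝓝 (∫ x, f x ∂μ))) (f : C(M, ℂ)) :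
    Tendsto (fun n => ∫ y, f y ∂((ρ n).comap (Subtype.val : M → Ω))) atTop
      (𝓝 (∫ y, f y ∂(μ.comap (Subtype.val : M → Ω)))) := by
  have hM := measurableSet_of_compactSpace M
  have hMc : IsClosed M := (isCompact_iff_compactSpace.2 ‹_›).isClosed
  have hreal : ∀ g : C(M, ℝ),
      Tendsto (fun n => ∫ y, g y ∂((ρ n).comap (Subtype.val : M → Ω))) atTop
        (𝓝 (∫ y, g y ∂(μ.comap (Subtype.val : M → Ω)))) := by
    intro g
    obtain ⟨G, -, hG⟩ := BoundedContinuousFunction.exists_extension_norm_eq_of_isClosedEmbedding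
      (BoundedContinuousFunction.mkOfCompact g) hMc.isClosedEmbedding_subtypeVal
    have e : ∀ σ : Measure Ω, σ Mᶜ = 0 →
        ∫ y, g y ∂(σ.comap (Subtype.val : M → Ω)) = ∫ x, G x ∂σ := by
      intro σ hσ
      have h1 : ∀ y : M, g y = G (y : Ω) := fun y => (congrFun hG y).symm
      simp only [h1]
      rw [integral_subtype_comap hM (fun x => G x), Measure.restrict_eq_self_of_ae_mem]
      exact hσ
    rw [e μ hμ]
    exact (h G).congr fun n => (e _ (hρ n)).symm
  have hre := hreal ⟨fun y => (f y).re, by fun_prop⟩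
  have him := hreal ⟨fun y => (f y).im, by fun_prop⟩
  have key : ∀ (σ : Measure Ω) [IsFiniteMeasure σ],
      ∫ y, f y ∂(σ.comap (Subtype.val : M → Ω)) =
      ((∫ y, (f y).re ∂(σ.comap (Subtype.val : M → Ω)) : ℝ) : ℂ) +
        ((∫ y, (f y).im ∂(σ.comap (Subtype.val : M → Ω)) : ℝ) : ℂ) * Complex.I := by
    intro σ _
    exact (integral_re_add_im (integrable_continuousMap _ f.continuous)).symm
  simp only [key]
  exact ((Complex.continuous_ofReal.tendsto _).comp hre).add
    (((Complex.continuous_ofReal.tendsto _).comp him).mul_const _)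

theorem samplingMeasure_compl (Φ : Flow ℝ Ω) {M : Set Ω} [CompactSpace M]
    (hM : IsForwardInvariant Φ M) {x₀ : Ω} (hx₀ : x₀ ∈ M) {Δt : ℝ} (hΔt : 0 ≤ Δt) (N : ℕ) :
    samplingMeasure Φ x₀ Δt N Mᶜ = 0 := by
  have hMm := (measurableSet_of_compactSpace M).compl
  rw [samplingMeasure, Measure.smul_apply, Measure.finsetSum_apply]
  rw [Finset.sum_eq_zero, smul_zero]
  intro n _
  rw [Measure.dirac_apply' _ hMm, indicator_of_notMem]
  exact fun h => h (hM (mul_nonneg n.cast_nonneg hΔt) hx₀)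

end WeakConvergence

/-! ### Discretization of the delay-coordinate distance -/

section RiemannSum

/-- The error of a Riemann sum, in terms of a modulus of continuity of the integrand. -/
theorem abs_riemannSum_sub_average_le {g : ℝ → ℝ} (hg : Continuous g) {T ε δ : ℝ} (hT : 0 < T)
    (hmod : ∀ s ∈ Icc 0 T, ∀ t ∈ Icc 0 T, |s - t| ≤ δ → |g s - g t| ≤ ε) {Q : ℕ} (hQ : 0 < Q)
    (hδ : T / Q ≤ δ) :
    |(Q : ℝ)⁻¹ * ∑ q ∈ Finset.range Q, g ((q : ℝ) * (T / Q)) - T⁻¹ * ∫ t in (0 : ℝ)..T, g t| ≤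
      ε := by
  have hQ' : (0 : ℝ) < Q := by exact_mod_cast hQ
  set d := T / Q with hd
  have hd0 : 0 < d := by positivity
  have hQd : (Q : ℝ) * d = T := by rw [hd]; field_simp
  have hsplit : ∫ t in (0 : ℝ)..T, g t =
      ∑ q ∈ Finset.range Q, ∫ t in ((q : ℝ) * d)..(((q + 1 : ℕ) : ℝ) * d), g t := by
    rw [intervalIntegral.sum_integral_adjacent_intervals (a := fun q : ℕ => (q : ℝ) * d)
      fun q _ => hg.intervalIntegrable _ _]
    simp [hQd]
  have hconst : ∀ q : ℕ, d * g ((q : ℝ) * d) =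
      ∫ _t in ((q : ℝ) * d)..(((q + 1 : ℕ) : ℝ) * d), g ((q : ℝ) * d) := fun q => by
    rw [intervalIntegral.integral_const, smul_eq_mul]
    push_cast
    ring
  have e1 : (Q : ℝ)⁻¹ * ∑ q ∈ Finset.range Q, g ((q : ℝ) * d) - T⁻¹ * ∫ t in (0 : ℝ)..T, g t =
      T⁻¹ * ∑ q ∈ Finset.range Q, ∫ t in ((q : ℝ) * d)..(((q + 1 : ℕ) : ℝ) * d),
        (g ((q : ℝ) * d) - g t) := by
    have : (Q : ℝ)⁻¹ = T⁻¹ * d := by rw [hd]; field_simp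
    rw [this, mul_assoc, Finset.mul_sum, hsplit, ← mul_sub, ← Finset.sum_sub_distrib]
    congr 1
    refine Finset.sum_congr rfl fun q _ => ?_
    rw [hconst, intervalIntegral.integral_sub (continuous_const.intervalIntegrable _ _)
      (hg.intervalIntegrable _ _)]
  have hterm : ∀ q ∈ Finset.range Q, |∫ t in ((q : ℝ) * d)..(((q + 1 : ℕ) : ℝ) * d),
      (g ((q : ℝ) * d) - g t)| ≤ ε * d := by
    intro q hq
    have hqQ : ((q + 1 : ℕ) : ℝ) ≤ Q := by exact_mod_cast Finset.mem_range.1 hq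
    have hle : (q : ℝ) * d ≤ ((q + 1 : ℕ) : ℝ) * d := by push_cast; nlinarith
    have h1 := intervalIntegral.norm_integral_le_of_norm_le_const (a := (q : ℝ) * d)
      (b := ((q + 1 : ℕ) : ℝ) * d) (f := fun t => g ((q : ℝ) * d) - g t) (C := ε) fun t ht => by
        rw [uIoc_of_le hle] at ht
        have hq0 : 0 ≤ (q : ℝ) * d := by positivity
        have htT : ((q + 1 : ℕ) : ℝ) * d ≤ T := by rw [← hQd]; gcongr
        refine hmod _ ⟨hq0, hle.trans htT⟩ _ ⟨hq0.trans ht.1.le, ht.2.trans htT⟩ ?_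
        have h2 := ht.2
        push_cast at h2
        rw [abs_sub_comm, abs_of_pos (by linarith [ht.1])]
        linarith
    rw [Real.norm_eq_abs] at h1
    refine h1.trans (le_of_eq ?_)
    rw [abs_of_nonneg (by linarith)]
    push_cast
    ring
  rw [e1, abs_mul, abs_of_pos (inv_pos.2 hT)]
  calc T⁻¹ * |∑ q ∈ Finset.range Q, ∫ t in ((q : ℝ) * d)..(((q + 1 : ℕ) : ℝ) * d),
        (g ((q : ℝ) * d) - g t)|
      ≤ T⁻¹ * ∑ _q ∈ Finset.range Q, ε * d := by
        gcongr
        exact (Finset.abs_sum_le_sum_abs _ _).trans (Finset.sum_le_sum hterm)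
    _ = T⁻¹ * (Q * d) * ε := by
        rw [Finset.sum_const, Finset.card_range, nsmul_eq_mul]
        ring
    _ = ε := by rw [hQd, inv_mul_cancel₀ hT.ne', one_mul]

end RiemannSum

section Kernels

variable {Ω : Type*} [MetricSpace Ω] {Y : Type*} [NormedAddCommGroup Y]

theorem ShapeFunction.exists_lipschitz (h : ShapeFunction) :
    ∃ C, 0 ≤ C ∧ ∀ u v, 0 ≤ u → 0 ≤ v → |h.toFun u - h.toFun v| ≤ C * |u - v| := by
  obtain ⟨C, hC⟩ := h.deriv_bounded
  refine ⟨C, (abs_nonneg _).trans (hC 0 le_rfl), fun u v hu hv => ?_⟩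
  exact (convex_Ici 0).norm_image_sub_le_of_norm_derivWithin_le
    (h.contDiffOn.differentiableOn one_ne_zero) (fun x hx => hC x hx) hv hu

/-- The discretized distances converge uniformly on `M`, because `t ↦ ‖F(Φᵗ x) - F(Φᵗ y)‖²` is
equicontinuous on `[0, T]` for `x, y ∈ M`. -/
theorem exists_discreteDelayDistSq_close (Φ : Flow ℝ Ω) (F : C(Ω, Y)) (M : Set Ω) [CompactSpace M]
    {T : ℝ} (hT : 0 < T) {ε : ℝ} (hε : 0 < ε) :
    ∃ δ > 0, ∀ Q : ℕ, 0 < Q → T / Q ≤ δ → ∀ x ∈ M, ∀ y ∈ M,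
      |discreteDelayDistSq Φ F T Q x y - delayDistSq Φ F T x y| ≤ ε := by
  let g : C(ℝ × (M × M), ℝ) := ⟨fun p => ‖F (Φ p.1 p.2.1) - F (Φ p.1 p.2.2)‖ ^ 2, by
    have h1 : Continuous fun p : ℝ × (M × M) => Φ p.1 (p.2.1 : Ω) :=
      Φ.continuous continuous_fst (by fun_prop)
    have h2 : Continuous fun p : ℝ × (M × M) => Φ p.1 (p.2.2 : Ω) :=
      Φ.continuous continuous_fst (by fun_prop)
    exact (((F.continuous.comp h1).sub (F.continuous.comp h2)).norm).pow 2⟩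
  have huc := (isCompact_Icc (a := (0 : ℝ)) (b := T)).uniformContinuousOn_of_continuous
    g.curry.continuous.continuousOn
  obtain ⟨δ, hδ, h⟩ := Metric.uniformContinuousOn_iff_le.1 huc ε hε
  refine ⟨δ, hδ, fun Q hQ hQδ x hx y hy => ?_⟩
  refine abs_riemannSum_sub_average_le (g := fun t => ‖F (Φ t x) - F (Φ t y)‖ ^ 2) ?_ hT
    (fun s hs t ht hst => ?_) hQ hQδ
  · exact g.continuous.comp (Continuous.prodMk_left ((⟨x, hx⟩, ⟨y, hy⟩) : M × M))
  · have h1 := h s hs t ht hst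
    exact (ContinuousMap.dist_apply_le_dist (f := g.curry s) (g := g.curry t)
      ((⟨x, hx⟩, ⟨y, hy⟩) : M × M)).trans h1

theorem delayKernel_symm (h : ShapeFunction) (Φ : Flow ℝ Ω) (F : C(Ω, Y)) (T : ℝ) (x y : Ω) :
    delayKernel h Φ F T (x, y) = delayKernel h Φ F T (y, x) := by
  change h.toFun _ = h.toFun _
  simp only [delayDistSq, norm_sub_rev]

theorem discreteDelayKernel_symm (h : ShapeFunction) (Φ : Flow ℝ Ω) (F : C(Ω, Y)) (T : ℝ) (Q : ℕ)
    (x y : Ω) : discreteDelayKernel h Φ F T Q (x, y) = discreteDelayKernel h Φ F T Q (y, x) := by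
  change h.toFun _ = h.toFun _
  simp only [discreteDelayDistSq, norm_sub_rev]

variable [MeasurableSpace Ω] [BorelSpace Ω]

theorem tendsto_integralOperator_discreteDelayKernel (M : Set Ω) [CompactSpace M]
    (h : ShapeFunction) (Φ : Flow ℝ Ω) (F : C(Ω, Y)) {T : ℝ} (hT : 0 < T) (μ : Measure Ω)
    [IsFiniteMeasure μ] {Q : ℕ → ℕ} (hQ_pos : ∀ i, 0 < Q i) (hQ : Tendsto Q atTop atTop) :
    Tendsto (fun i => integralOperator M (discreteDelayKernel h Φ F T (Q i)) μ) atTop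
      (𝓝 (integralOperator M (delayKernel h Φ F T) μ)) := by
  rw [tendsto_iff_norm_sub_tendsto_zero]
  refine tendsto_order.2 ⟨fun a ha => Eventually.of_forall fun n => ha.trans_le (norm_nonneg _),
    fun ε hε => ?_⟩
  obtain ⟨C, hC0, hC⟩ := h.exists_lipschitz
  set m := (μ.comap (Subtype.val : M → Ω)).real univ with hm
  have hm0 : 0 ≤ m := measureReal_nonneg
  obtain ⟨δ, hδ, hclose⟩ := exists_discreteDelayDistSq_close Φ F M hT
    (ε := ε / (2 * (C * m + 1))) (by positivity)
  have hlim : Tendsto (fun i => T / (Q i : ℝ)) atTop (𝓝 0) :=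
    (tendsto_natCast_atTop_atTop.comp hQ).const_div_atTop T
  filter_upwards [hlim.eventually_le_const hδ] with i hi
  rw [integralOperator_sub]
  have h1 := norm_integralOperator_le (M := M)
    (discreteDelayKernel h Φ F T (Q i) - delayKernel h Φ F T) μ
    (c := C * (ε / (2 * (C * m + 1)))) (by positivity) fun x hx y hy =>
      (hC _ _ (discreteDelayDistSq_nonneg Φ F T (Q i) x y) (delayDistSq_nonneg Φ F T x y)).trans
        (by gcongr; exact hclose (Q i) (hQ_pos i) hi x hx y hy)
  refine h1.trans_lt ?_
  rw [← hm]
  calc C * (ε / (2 * (C * m + 1))) * m = (C * m) / (C * m + 1) * (ε / 2) := by field_simp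
    _ ≤ 1 * (ε / 2) := by
        gcongr
        rw [div_le_one (by positivity)]
        linarith
    _ < ε := by linarith

end Kernels

end DelayKernel

theorem proposition4
    {Ω : Type*} [MetricSpace Ω] [MeasurableSpace Ω] [BorelSpace Ω]
    {Y : Type*} [NormedAddCommGroup Y] [NormedSpace ℝ Y] [CompleteSpace Y]
    -- the flow and its ergodic invariant probability measure with compact support `X`
    (Φ : Flow ℝ Ω) (μ : Measure Ω) [IsProbabilityMeasure μ]
    (hμ : DelayKernel.IsErgodicFlow Φ μ)
    (X : Set Ω) (hX : IsCompact X) (hX_supp : X = μ.support) (hX_full : μ Xᶜ = 0)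
    -- the forward-invariant compact `C¹` manifold `M`
    (M : Set Ω) [CompactSpace M] (hXM : X ⊆ M) (hM : IsForwardInvariant Φ M)
    {E : Type*} [NormedAddCommGroup E] [NormedSpace ℝ E] [FiniteDimensional ℝ E]
    {H : Type*} [TopologicalSpace H] (I : ModelWithCorners ℝ E H)
    [ChartedSpace H M] [IsManifold I 1 M]
    (hΦ : ∀ (t : ℝ) (ht : 0 ≤ t), ContMDiff I I 1 (hM ht).restrict)
    -- the observation map, the shape function and the delay window
    (F : C(Ω, Y)) (hF : ContMDiff I 𝓘(ℝ, Y) 1 (fun x : M => F x))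
    (h : DelayKernel.ShapeFunction) (T : ℝ) (hT : 0 < T)
    -- the initial state and the sequence of sampling intervals `Δt = T / Q i → 0`
    (x₀ : Ω) (hx₀ : x₀ ∈ DelayKernel.basin Φ μ ∩ M)
    (Q : ℕ → ℕ) (hQ_pos : ∀ i, 0 < Q i) (hQ : Tendsto Q atTop atTop)
    (hweak : ∀ i, DelayKernel.SamplingConverges Φ μ x₀ (T / Q i))
    -- the nonzero eigenvalue
    (e : DelayKernel.SpectrumEnd) (j : ℕ)
    (hj : DelayKernel.orderedEigenvalue e (DelayKernel.limitOperator M h Φ F μ T) j ≠ 0) :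
    let K : C(M, ℂ) →L[ℂ] C(M, ℂ) := DelayKernel.limitOperator M h Φ F μ T
    let KN : ℕ → ℕ → C(M, ℂ) →L[ℂ] C(M, ℂ) := fun i N =>
      DelayKernel.dataOperator M h Φ F x₀ T (Q i) N
    let lam : ℕ → ℝ := DelayKernel.orderedEigenvalue e K
    let lamN : ℕ → ℕ → ℕ → ℝ := fun i N => DelayKernel.orderedEigenvalue e (KN i N)
    -- convergence of the `j`-th eigenvalues
    DelayKernel.IteratedLimit (fun i N => lamN i N j) (lam j) ∧
    -- strong convergence of the spectral projections
    (∀ S : Set ℂ, S ∈ 𝓝 (lam j : ℂ) → spectrum ℂ K ∩ closure S = {(lam j : ℂ)} →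
      DelayKernel.StrongIteratedLimit (fun i N => DelayKernel.spectralProjection (KN i N) S)
        (DelayKernel.rieszProjection K (lam j : ℂ))) ∧
    -- uniform convergence of eigenfunctions, simple eigenvalue
    (Module.finrank ℂ (DelayKernel.eigenspace K (lam j : ℂ)) = 1 →
      ∀ φ : C(M, ℂ), Module.End.HasEigenvector (K : C(M, ℂ) →ₗ[ℂ] C(M, ℂ)) (lam j : ℂ) φ →
        ∃ ψ : ℕ → ℕ → C(M, ℂ),
          (∀ᶠ i in atTop, ∀ᶠ N in atTop,
            Module.End.HasEigenvector (KN i N : C(M, ℂ) →ₗ[ℂ] C(M, ℂ))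
              (lamN i N j : ℂ) (ψ i N)) ∧
          DelayKernel.IteratedLimit (fun i N => ‖ψ i N - φ‖) 0) ∧
    -- uniform convergence of eigenfunctions, arbitrary multiplicity
    (∀ φ : C(M, ℂ), Module.End.HasEigenvector (K : C(M, ℂ) →ₗ[ℂ] C(M, ℂ)) (lam j : ℂ) φ →
      ∃ ψ : ℕ → ℕ → C(M, ℂ),
        (∀ᶠ i in atTop, ∀ᶠ N in atTop, ψ i N ≠ 0 ∧
          ψ i N ∈ ⨆ k ∈ {k : ℕ | lam k = lam j},
            DelayKernel.eigenspace (KN i N) (lamN i N k : ℂ)) ∧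
        DelayKernel.IteratedLimit (fun i N => ‖ψ i N - φ‖) 0) := by
  intro K KN lam lamN
  obtain ⟨hx₀b, hx₀M⟩ := hx₀
  -- the operators between the two limits: discretized kernel, integrated against `μ`
  let K' : ℕ → C(M, ℂ) →L[ℂ] C(M, ℂ) := fun i =>
    DelayKernel.integralOperator M (DelayKernel.discreteDelayKernel h Φ F T (Q i)) μ
  have hK : DelayKernel.SymmetrizableCompact K :=
    DelayKernel.symmetrizableCompact_integralOperator _ (DelayKernel.delayKernel_symm h Φ F T) μ
  have hK' : ∀ i, DelayKernel.SymmetrizableCompact (K' i) := fun i =>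
    DelayKernel.symmetrizableCompact_integralOperator _
      (DelayKernel.discreteDelayKernel_symm h Φ F T (Q i)) μ
  have hKN : ∀ i N, DelayKernel.SymmetrizableCompact (KN i N) := fun i N =>
    DelayKernel.symmetrizableCompact_integralOperator _
      (DelayKernel.discreteDelayKernel_symm h Φ F T (Q i)) _
  have hμM : μ Mᶜ = 0 := measure_mono_null (compl_subset_compl.2 hXM) hX_full
  have hconv : ∀ i, DelayKernel.NuTendsto (KN i) (K' i) := fun i =>
    DelayKernel.nuTendsto_integralOperator _ (fun N => DelayKernel.samplingMeasure Φ x₀ (T / Q i) N)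
      μ
      (fun N => by
        rw [DelayKernel.comap_real_univ]
        exact DelayKernel.samplingMeasure_real_le_one Φ x₀ _ N M)
      (by
        rw [DelayKernel.comap_real_univ]
        exact measureReal_le_one)
      (DelayKernel.tendsto_integral_comap
        (DelayKernel.samplingMeasure_compl Φ hM hx₀M (by positivity)) hμM (hweak i))
  have hconv' : DelayKernel.NuTendsto K' K := DelayKernel.NuTendsto.of_tendsto
    (DelayKernel.tendsto_integralOperator_discreteDelayKernel M h Φ F hT μ hQ_pos hQ)
  have hlam : lam j ≠ 0 := hj
  -- eigenvectors converge, from either end of the spectrum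
  have hvec : ∀ φ : C(M, ℂ),
      Module.End.HasEigenvector (K : C(M, ℂ) →ₗ[ℂ] C(M, ℂ)) (lam j : ℂ) φ →
      ∃ ψ : ℕ → ℕ → C(M, ℂ),
        (∀ᶠ i in atTop, ∀ᶠ N in atTop, ψ i N ≠ 0 ∧
          ψ i N ∈ ⨆ k ∈ {k : ℕ | lam k = lam j},
            DelayKernel.eigenspace (KN i N) (lamN i N k : ℂ)) ∧
        DelayKernel.IteratedLimit (fun i N => ‖ψ i N - φ‖) 0 := by
    intro φ hφ
    have hφ1 : K φ = (lam j : ℂ) • φ := DelayKernel.mem_eigenspace.1 hφ.1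
    cases e with
    | top =>
      exact DelayKernel.exists_iteratedLimit_eigenvectors hKN hK' hK hconv hconv'
        (lt_of_le_of_ne (DelayKernel.topEigenvalue_nonneg K j) hlam.symm) hφ.2 hφ1
    | bottom =>
      have hlamk : ∀ k, lam k = -DelayKernel.topEigenvalue (-K) k := fun _ => rfl
      have hlamNk : ∀ i N k, lamN i N k = -DelayKernel.topEigenvalue (-KN i N) k :=
        fun _ _ _ => rfl
      obtain ⟨ψ, h1, h2⟩ := DelayKernel.exists_iteratedLimit_eigenvectors
        (fun i N => (hKN i N).neg) (fun i => (hK' i).neg) hK.neg (fun i => (hconv i).neg)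
        hconv'.neg (t := DelayKernel.topEigenvalue (-K) j)
        (lt_of_le_of_ne (DelayKernel.topEigenvalue_nonneg (-K) j)
          fun h0 => hlam (by rw [hlamk, ← h0, neg_zero])) hφ.2
        (by rw [neg_apply, hφ1, hlamk, Complex.ofReal_neg, neg_smul, neg_neg])
      refine ⟨ψ, h1.mono fun i hi => hi.mono fun N hN => ?_, h2⟩
      simpa only [hlamk, hlamNk, neg_inj, Complex.ofReal_neg, ← DelayKernel.eigenspace_neg]
        using hN
  have hunique : Module.finrank ℂ (DelayKernel.eigenspace K (lam j : ℂ)) = 1 →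
      ∀ k, lam k = lam j → k = j := by
    intro hdim k hk
    cases e with
    | top =>
      exact hK.index_unique (lt_of_le_of_ne (DelayKernel.topEigenvalue_nonneg K j) hlam.symm)
        hdim hk rfl
    | bottom =>
      have hlamk : ∀ k, lam k = -DelayKernel.topEigenvalue (-K) k := fun _ => rfl
      rw [hlamk, hlamk, neg_inj] at hk
      rw [hlamk, Complex.ofReal_neg, ← DelayKernel.eigenspace_neg] at hdim
      exact hK.neg.index_unique (lt_of_le_of_ne (DelayKernel.topEigenvalue_nonneg (-K) j)
          fun h0 => hlam (by rw [hlamk, ← h0, neg_zero])) hdim hk rfl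
  refine ⟨?_, fun S hS hSK => ?_, fun hdim φ hφ => ?_, hvec⟩
  · cases e with
    | top => exact DelayKernel.iteratedLimit_topEigenvalue hKN hK' hK hconv hconv' j
    | bottom =>
      obtain ⟨b, hb, hb'⟩ := DelayKernel.iteratedLimit_topEigenvalue (fun i N => (hKN i N).neg)
        (fun i => (hK' i).neg) hK.neg (fun i => (hconv i).neg) hconv'.neg j
      exact ⟨fun i => -b i, hb.mono fun i hi => hi.neg, hb'.neg⟩
  · exact DelayKernel.strongIteratedLimit_spectralProjection hKN hconv hconv'
      (by exact_mod_cast hlam) hS hSK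
  · obtain ⟨ψ, h1, h2⟩ := hvec φ hφ
    refine ⟨ψ, h1.mono fun i hi => hi.mono fun N hN => ⟨?_, hN.1⟩, h2⟩
    have hle : (⨆ k ∈ {k : ℕ | lam k = lam j},
        DelayKernel.eigenspace (KN i N) (lamN i N k : ℂ)) ≤
        DelayKernel.eigenspace (KN i N) (lamN i N j : ℂ) :=
      iSup₂_le fun k hk => by rw [hunique hdim k hk]
    exact hle hN.2
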